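/- **Setting.** A value distribution $D$ is a continuous distribution on $[0,\infty)$ with density $g$ and cumulative distribution function $F$. Its virtual value is $\varphi(v)=v-\frac{1-F(v)}{g(v)}$, with $\varphi=-\infty$ below the support and $\varphi(v)=v$ above it. $D$ is regular if $\varphi$ is nondecreasing, and $\alpha$-strongly regular if $\varphi(v)-\varphi(\hat v)\ge\alpha(v-\hat v)$ for all $v\ge\hat v$. Its monopoly reserve is $r=\sup\{v:\varphi(v)<0\}$. There are $n\ge 1$ real bidders with independent values $v_i\sim D_i$, and a matroid $\mathcal F$ on the bidders whose independent sets are the sets that can be allocated simultaneously. In the *deferred-revelation auction* (DRA) over a public ledger with collateral $f$, the real bidders commit to their values. Before seeing any value, the auctioneer chooses finitely many fabricated bids (nonnegative numbers), and declares a matroid $\hat{\mathcal F}$ on the set of all real and fabricated bidders, a regular distribution $\hat D_j$ with virtual value $\hat\varphi_j$ for each of them, and distinct integer identifiers used for tie-breaking. After all real bids $\vec v$ are revealed, the auctioneer may conceal a set $C(\vec v)$ of its fabricated bids (depending measurably on $\vec v$), and pays $f$ for each concealed bid. Among the sets $S\in\hat{\mathcal F}$ of revealed bids, the one maximizing $\sum_{j\in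 S}\hat\varphi_j(b_j)$ is allocated, ties being broken lexicographically by identifier (the set containing the smallest identifier on which two sets differ is preferred). Each allocated bidder pays its critical bid, i.e. the infimum of the nonnegative bids with which it would be allocated, the other revealed bids being fixed. A strategy is admissible if the set of allocated real bidders belongs to $\mathcal F$ for almost every $\vec v\sim\prod_i D_i$. The auctioneer's revenue is the sum of the payments of the real bidders minus $f\cdot|C(\vec v)|$. The DRA is *credible* for the collateral $f$ if the honest strategy (no fabricated bids, $\hat{\mathcal F}=\mathcal F$, $\hat D_i=D_i$) is admissible and maximizes the expected revenue over all admissible strategies, all of which have integrable revenue. **Theorem.** Let $0<\alpha<1$. 1. Let $n\ge1$, let $\mathcal F$ be a matroid feasibility constraint on $n$ bidders, and let $D_1,\dots,D_n$ be $\alpha$-strongly regular value distributions with monopoly reserves $r_1,\dots,r_n$ and $R=\max_i r_i$. Then the DRA is credible for every collateral $f\ge R$ satisfying $$\frac1\alpha\left(\frac{R}{(1-\alpha)f+\alpha R}\right)^{\frac1{1-\alpha}}\cdot\frac fR\;\le\;\frac1n .$$ 2. In particular, for all such $n,\mathcal F,D_1,\dots,D_n$, the DRA is credible for the collateral $f=\left(\frac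 n\alpha\right)^{\frac{1-\alpha}{\alpha}}(1-\alpha)^{-\frac1\alpha}\cdot R$. 3. There is a real polynomial $p$, depending only on $\alpha$, such that for all such $n,\mathcal F,D_1,\dots,D_n$ the DRA is credible for the collateral $f=p(n)\cdot R$. -/

import Mathlib

open MeasureTheory
open scoped ENNReal NNReal

namespace DRA

noncomputable section

/-- A continuous distribution of a nonnegative value, given by its density. -/
structure ValueDist where
  pdf : ℝ → ℝ≥0
  measurable_pdf : Measurable pdf
  pdf_of_neg : ∀ v < 0, pdf v = 0
  lintegral_pdf : ∫⁻ v, (pdf v : ℝ≥0∞) = 1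

namespace ValueDist

/-- The law of the value. -/
def law (D : ValueDist) : Measure ℝ :=
  volume.withDensity fun v => (D.pdf v : ℝ≥0∞)

instance (D : ValueDist) : IsProbabilityMeasure D.law :=
  ⟨by rw [law, withDensity_apply _ MeasurableSet.univ, Measure.restrict_univ, D.lintegral_pdf]⟩

/-- The virtual value `φ(v) = v - (1 - F(v)) / pdf(v)`, where `1 - F(v) = Pr(value > v)`.
The quotient is taken in `[0, ∞]`, where `x / 0 = ∞` for `x > 0` and `0 / 0 = 0`. Hence `φ = -∞`
below the support, and `φ(v) = v` above it. -/
def virtualValue (D : ValueDist) (v : ℝ) : EReal :=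
  (v : EReal) - ((D.law (Set.Ioi v) / (D.pdf v : ℝ≥0∞) : ℝ≥0∞) : EReal)

/-- Regularity: the virtual value is nondecreasing. -/
def Regular (D : ValueDist) : Prop := Monotone D.virtualValue

/-- `α`-strong regularity: `φ(w) - φ(v) ≥ α (w - v)` whenever `v ≤ w`, with the negative (possibly
infinite) term moved to the other side. For `0 ≤ α ≤ 1` the conventions for `φ` outside the support
make this a condition on the support only. -/
def StronglyRegular (D : ValueDist) (α : ℝ) : Prop :=
  ∀ ⦃v w : ℝ⦄, v ≤ w → D.virtualValue v + ((α * (w - v) : ℝ) : EReal) ≤ D.virtualValue w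

/-- The monopoly reserve: the supremum of the values with negative virtual value. -/
def reserve (D : ValueDist) : ℝ := sSup {v : ℝ | D.virtualValue v < 0}

end ValueDist

/-- The largest monopoly reserve. -/
def maxReserve {n : ℕ} (D : Fin n → ValueDist) : ℝ := ⨆ i, (D i).reserve

/-- The smart contract for the bidders in `ι`: their identifiers on the ledger (used to break ties),
the declared matroid (feasible sets are the independent sets), and the declared distributions. -/
structure Contract (ι : Type) where
  ident : ι ↪ ℕ
  feasible : Matroid ι
  dist : ι → ValueDist

namespace Contract

variable {ι : Type} (c : Contract ι)

/-- The declared virtual surplus of the set `S` at the bids `b`. -/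
def surplus (b : ι → ℝ) (S : Finset ι) : EReal := ∑ i ∈ S, (c.dist i).virtualValue (b i)

/-- Lexicographic priority: the smallest identifier in which `S` and `T` differ belongs to `S`. -/
def Precedes (S T : Finset ι) : Prop :=
  ∃ i ∈ S, i ∉ T ∧ ∀ j ∈ T, j ∉ S → c.ident i < c.ident j

/-- `S` is the feasible subset of the set `A` of revealed bids that has the largest declared virtual
surplus, ties being broken lexicographically. -/
def IsOptimal (b : ι → ℝ) (A S : Finset ι) : Prop :=
  S ⊆ A ∧ c.feasible.Indep S ∧
    ∀ T ⊆ A, c.feasible.Indep T → T ≠ S →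
      c.surplus b T < c.surplus b S ∨ (c.surplus b T = c.surplus b S ∧ c.Precedes S T)

/-- Bidder `i` is allocated when the bids are `b` and the set of revealed bids is `A`. -/
def Wins (b : ι → ℝ) (A : Finset ι) (i : ι) : Prop := ∃ S, c.IsOptimal b A S ∧ i ∈ S

open Classical in
/-- The critical bid of `i`: the infimum of the bids with which `i` is allocated, when the other
revealed bids are kept fixed. -/
def criticalBid (b : ι → ℝ) (A : Finset ι) (i : ι) : ℝ :=
  sInf {x : ℝ | 0 ≤ x ∧ c.Wins (Function.update b i x) A i}

open Classical in
/-- An allocated bidder pays its critical bid, the others pay nothing. -/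
def payment (b : ι → ℝ) (A : Finset ι) (i : ι) : ℝ :=
  if c.Wins b A i then c.criticalBid b A i else 0

end Contract

/-- A (deterministic) strategy of the auctioneer facing `n` real bidders: the fabricated bids, the
contract for real and fabricated bidders, and the set of fabricated bids to be concealed as a
function of the bids revealed by the real bidders. -/
structure Strategy (n : ℕ) where
  numFake : ℕ
  fakeBid : Fin numFake → ℝ
  fakeBid_nonneg : ∀ j, 0 ≤ fakeBid j
  contract : Contract (Fin n ⊕ Fin numFake)
  conceal : (Fin n → ℝ) → Finset (Fin numFake)
  measurable_conceal : ∀ j, MeasurableSet {v | j ∈ conceal v}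

namespace Strategy

variable {n : ℕ} (π : Strategy n)

/-- All committed bids, when the real bidders bid `v`. -/
def bids (v : Fin n → ℝ) : Fin n ⊕ Fin π.numFake → ℝ := Sum.elim v π.fakeBid

/-- The revealed bids: those of all the real bidders, and the fabricated ones not concealed. -/
def revealed (v : Fin n → ℝ) : Finset (Fin n ⊕ Fin π.numFake) :=
  Finset.univ.disjSum (π.conceal v)ᶜ

/-- The set of real bidders that are allocated. -/
def allocated (v : Fin n → ℝ) : Set (Fin n) :=
  {i | π.contract.Wins (π.bids v) (π.revealed v) (Sum.inl i)}

/-- The auctioneer's revenue: the payments of the real bidders, minus the burnt collateral `f` for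
each concealed bid. -/
def revenue (f : ℝ) (v : Fin n → ℝ) : ℝ :=
  ∑ i, π.contract.payment (π.bids v) (π.revealed v) (Sum.inl i) - f * ((π.conceal v).card : ℝ)

/-- The strategies open to the auctioneer: the declared distributions are regular, and the set of
real bidders that are allocated is feasible. -/
def Admissible (M : Matroid (Fin n)) (D : Fin n → ValueDist) : Prop :=
  (∀ i, (π.contract.dist i).Regular) ∧
    ∀ᵐ v ∂(Measure.pi fun i => (D i).law), M.Indep (π.allocated v)

/-- The honest strategy: no fabricated bids, and the true feasibility constraint and distributions
are declared. -/
def honest (M : Matroid (Fin n)) (D : Fin n → ValueDist) : Strategy n where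
  numFake := 0
  fakeBid := Fin.elim0
  fakeBid_nonneg := fun j => j.elim0
  contract :=
    { ident := (Equiv.sumEmpty (Fin n) (Fin 0)).toEmbedding.trans Fin.valEmbedding
      feasible := M.mapEquiv (Equiv.sumEmpty (Fin n) (Fin 0)).symm
      dist := fun i => D (Equiv.sumEmpty (Fin n) (Fin 0) i) }
  conceal := fun _ => ∅
  measurable_conceal := fun j => j.elim0

end Strategy

/-- The deferred-revelation auction with collateral `f` is credible: when the real bidders bid their
values, drawn independently from `D`, the honest strategy maximizes the auctioneer's expected
revenue over all admissible strategies. -/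
def Credible {n : ℕ} (M : Matroid (Fin n)) (D : Fin n → ValueDist) (f : ℝ) : Prop :=
  (Strategy.honest M D).Admissible M D ∧
    ∀ π : Strategy n, π.Admissible M D →
      Integrable (π.revenue f) (Measure.pi fun i => (D i).law) ∧
      ∫ v, π.revenue f v ∂(Measure.pi fun i => (D i).law) ≤
        ∫ v, (Strategy.honest M D).revenue f v ∂(Measure.pi fun i => (D i).law)

end

end DRA

namespace DRA

/-! Compare any strategy with the allocation it would produce if nothing were concealed
(`Strategy.fullOpt`). On a matroid the allocation is greedy (`Contract.mem_opt_iff`), so concealing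
k bids keeps every real winner, only lowers its price, and adds at most k winners. An added winner
pays at most its value v_i and accounts for one burnt f, so it is worth at most (v_i - f)⁺. If v_i ≥
f it is `Strategy.Pivotal`: a condition on the other bids alone, under which i can feasibly be
served together with the real winners of `fullOpt`.

Fix the other bids and average over v_i. If i is not pivotal, its contribution is a posted-price
revenue, at most the expectation of φ_i⁺ on the event that i wins (Myerson). If i is pivotal, its
contribution is at most (f/α)·Pr(v_i > f): above the reserve r, strong regularity bounds the inverse
hazard rate by L(v) = αr + (1-α)v, which controls the tail integrals. It also makes
L(t)^{1/(1-α)}·Pr(v_i > t) nonincreasing, and with the hypothesis on f this brings the bound below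
E[φ_i⁺]/n (`ofReal_div_mul_tail_le`).

These credits fit into one feasible set (`Strategy.sum_credit_le`): at most n pivotal bidders of
weight 1/n cost no more than the pivotal k with the largest φ_k⁺, and k together with the nonpivotal
winners is feasible. Hence the credits stay below the largest feasible sum of the φ_i⁺, which the
honest allocation attains and the honest payments collect in expectation. The explicit collaterals
are then a computation with `tailFactor`. -/

theorem ValueDist.virtualValue_ne_top (D : ValueDist) (v : ℝ) : D.virtualValue v ≠ ⊤ := by
  unfold ValueDist.virtualValue
  rw [sub_eq_add_neg]
  exact EReal.add_ne_top (EReal.coe_ne_top v) (by simp)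

/-- The density vanishes while the tail has positive mass, so the quotient is infinite. A negative
bid therefore acts as a withdrawal from the auction. -/
theorem ValueDist.virtualValue_of_neg (D : ValueDist) {v : ℝ} (hv : v < 0) :
    D.virtualValue v = ⊥ := by
  have h : D.law (Set.Ioi v) ≠ 0 := by
    intro h0
    have h1 : D.law (Set.Iic v) = 0 := by
      rw [ValueDist.law, withDensity_apply _ measurableSet_Iic]
      refine (setLIntegral_congr_fun measurableSet_Iic (g := fun _ => 0) ?_).trans (by simp)
      intro x hx
      simp [D.pdf_of_neg x (lt_of_le_of_lt hx hv)]
    have h2 : D.law Set.univ ≤ 0 := by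
      rw [← Set.Iic_union_Ioi (a := v)]
      exact (measure_union_le _ _).trans (by simp [h0, h1])
    simp at h2
  unfold ValueDist.virtualValue
  rw [D.pdf_of_neg v hv, ENNReal.coe_zero, ENNReal.div_zero h]
  simp

/-! ### The allocation rule as a greedy algorithm on a matroid -/

namespace Contract

variable {ι : Type} (c : Contract ι)

open Classical in
theorem surplus_insert (b : ι → ℝ) {S : Finset ι} {i : ι} (hi : i ∉ S) :
    c.surplus b (insert i S) = (c.dist i).virtualValue (b i) + c.surplus b S := by
  simp [surplus, Finset.sum_insert hi]

open Classical in
theorem surplus_eq_add_erase (b : ι → ℝ) {S : Finset ι} {i : ι} (hi : i ∈ S) :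
    c.surplus b S = (c.dist i).virtualValue (b i) + c.surplus b (S.erase i) := by
  rw [← c.surplus_insert b (Finset.notMem_erase i S), Finset.insert_erase hi]

theorem surplus_ne_top (b : ι → ℝ) (S : Finset ι) : c.surplus b S ≠ ⊤ := by
  classical
  induction S using Finset.induction_on with
  | empty => simp [surplus]
  | insert i S hi ih =>
    rw [c.surplus_insert b hi]
    exact EReal.add_ne_top ((c.dist i).virtualValue_ne_top _) ih

theorem precedes_asymm {S T : Finset ι} (h : c.Precedes S T) : ¬ c.Precedes T S := by
  rintro ⟨j, hjT, hjS, hj⟩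
  obtain ⟨i, hiS, hiT, hi⟩ := h
  exact lt_asymm (hi j hjT hjS) (hj i hiS hiT)

/-- The tie-breaking order is the colexicographic order on the sets of reversed identifiers. -/
def priority (S : Finset ι) : Colex (Finset ℕᵒᵈ) :=
  toColex (S.map (c.ident.trans OrderDual.toDual.toEmbedding))

theorem precedes_iff_priority_lt {S T : Finset ι} :
    c.Precedes S T ↔ c.priority T < c.priority S := by
  rw [priority, priority, Finset.Colex.toColex_lt_toColex_iff_exists_forall_lt]
  simp [Precedes, OrderDual.toDual_lt_toDual]

theorem priority_injective : Function.Injective c.priority := by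
  intro S T h
  exact Finset.map_injective _ h

variable {c} {b : ι → ℝ} {A : Finset ι}

theorem exists_isOptimal (c : Contract ι) (b : ι → ℝ) (A : Finset ι) :
    ∃ S, c.IsOptimal b A S := by
  classical
  -- Surplus first, priority second: an injective map into a linear order, so its maximizer beats
  -- every other set strictly.
  let key : Finset ι → EReal ×ₗ Colex (Finset ℕᵒᵈ) := fun S =>
    toLex (c.surplus b S, c.priority S)
  obtain ⟨S, hS, hmax⟩ := Finset.exists_max_image
    (A.powerset.filter fun S : Finset ι => c.feasible.Indep (S : Set ι)) key
    ⟨∅, by simp⟩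
  simp only [Finset.mem_filter, Finset.mem_powerset] at hS hmax
  refine ⟨S, hS.1, hS.2, fun T hTA hT hne => ?_⟩
  have hlt : key T < key S := by
    refine lt_of_le_of_ne (hmax T ⟨hTA, hT⟩) fun h => hne ?_
    exact c.priority_injective (congrArg (fun x => (ofLex x).2) h)
  rw [Prod.Lex.lt_iff] at hlt
  rw [precedes_iff_priority_lt]
  exact hlt

theorem IsOptimal.surplus_le {S : Finset ι} (h : c.IsOptimal b A S) {T : Finset ι} (hTA : T ⊆ A)
    (hT : c.feasible.Indep (T : Set ι)) : c.surplus b T ≤ c.surplus b S := by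
  by_cases hTS : T = S
  · rw [hTS]
  · rcases h.2.2 T hTA hT hTS with h1 | h1
    exacts [h1.le, h1.1.le]

theorem IsOptimal.eq {S T : Finset ι} (hS : c.IsOptimal b A S) (hT : c.IsOptimal b A T) :
    S = T := by
  by_contra hne
  rcases hS.2.2 T hT.1 hT.2.1 (Ne.symm hne) with h1 | h1
  · exact absurd (hT.surplus_le hS.1 hS.2.1) (not_le.2 h1)
  · rcases hT.2.2 S hS.1 hS.2.1 hne with h2 | h2
    · exact absurd h2 (by rw [h1.1]; exact lt_irrefl _)
    · exact c.precedes_asymm h1.2 h2.2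

/-- The allocated set. -/
noncomputable def opt (c : Contract ι) (b : ι → ℝ) (A : Finset ι) : Finset ι :=
  (c.exists_isOptimal b A).choose

theorem isOptimal_opt (c : Contract ι) (b : ι → ℝ) (A : Finset ι) :
    c.IsOptimal b A (c.opt b A) :=
  (c.exists_isOptimal b A).choose_spec

theorem wins_iff_mem_opt {i : ι} : c.Wins b A i ↔ i ∈ c.opt b A := by
  constructor
  · rintro ⟨S, hS, hi⟩
    rwa [(c.isOptimal_opt b A).eq hS]
  · exact fun hi => ⟨_, c.isOptimal_opt b A, hi⟩

theorem opt_indep (c : Contract ι) (b : ι → ℝ) (A : Finset ι) :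
    c.feasible.Indep (c.opt b A : Set ι) := (c.isOptimal_opt b A).2.1

theorem opt_subset (c : Contract ι) (b : ι → ℝ) (A : Finset ι) : c.opt b A ⊆ A :=
  (c.isOptimal_opt b A).1

theorem surplus_opt_nonneg (c : Contract ι) (b : ι → ℝ) (A : Finset ι) :
    0 ≤ c.surplus b (c.opt b A) := by
  have := (c.isOptimal_opt b A).surplus_le (T := ∅) (by simp) (by simp)
  simpa [surplus] using this

/-- The empty set is feasible, so the optimal surplus is nonnegative, whereas a summand `⊥` would
absorb the rest. This finiteness is what permits strict cancellation in `EReal`. -/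
theorem surplus_ne_bot_of_subset_opt {S : Finset ι} (hS : S ⊆ c.opt b A) :
    c.surplus b S ≠ ⊥ := by
  classical
  intro h
  have h0 := c.surplus_opt_nonneg b A
  have : c.surplus b (c.opt b A) = c.surplus b S + c.surplus b (c.opt b A \ S) := by
    rw [add_comm]; simp only [surplus]; rw [Finset.sum_sdiff hS]
  rw [this, h, EReal.bot_add] at h0
  exact absurd h0 (not_le.2 EReal.bot_lt_zero)

theorem virtualValue_nonneg_of_mem_opt {i : ι} (hi : i ∈ c.opt b A) :
    0 ≤ (c.dist i).virtualValue (b i) := by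
  classical
  have hle : c.surplus b ((c.opt b A).erase i) ≤ c.surplus b (c.opt b A) :=
    (c.isOptimal_opt b A).surplus_le ((Finset.erase_subset _ _).trans (c.opt_subset b A))
      ((c.opt_indep b A).subset (by simp))
  rw [c.surplus_eq_add_erase b hi] at hle
  by_contra! hneg
  have h1 := c.surplus_ne_top b ((c.opt b A).erase i)
  have h2 := surplus_ne_bot_of_subset_opt (Finset.erase_subset i (c.opt b A))
  have h3 := EReal.add_lt_add_of_lt_of_le' hneg (le_refl (c.surplus b ((c.opt b A).erase i))) h2
    (fun h => absurd h h1)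
  rw [zero_add] at h3
  exact absurd hle (not_le.2 h3)

/-- `j` comes before `i` in the greedy order. -/
def Better (c : Contract ι) (b : ι → ℝ) (j i : ι) : Prop :=
  (c.dist i).virtualValue (b i) < (c.dist j).virtualValue (b j) ∨
    ((c.dist i).virtualValue (b i) = (c.dist j).virtualValue (b j) ∧ c.ident j < c.ident i)

theorem Better.le {i j : ι} (h : c.Better b j i) :
    (c.dist i).virtualValue (b i) ≤ (c.dist j).virtualValue (b j) := by
  rcases h with h | h
  exacts [h.le, h.1.le]

theorem better_or_better {i j : ι} (h : i ≠ j) : c.Better b j i ∨ c.Better b i j := by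
  rcases lt_trichotomy ((c.dist i).virtualValue (b i)) ((c.dist j).virtualValue (b j)) with
    h1 | h1 | h1
  · exact Or.inl (Or.inl h1)
  · rcases lt_or_gt_of_ne (c.ident.injective.ne h) with h2 | h2
    · exact Or.inr (Or.inr ⟨h1.symm, h2⟩)
    · exact Or.inl (Or.inr ⟨h1, h2⟩)
  · exact Or.inr (Or.inl h1)

open Classical in
/-- No exchange of an allocated bidder for a better one is feasible. -/
theorem not_indep_exchange {i j : ι} (hi : i ∈ c.opt b A) (hj : j ∉ c.opt b A) (hjA : j ∈ A)
    (hji : c.Better b j i) :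
    ¬ c.feasible.Indep (insert j ((c.opt b A).erase i) : Finset ι) := by
  intro hind
  have hjE : j ∉ (c.opt b A).erase i := fun h => hj (Finset.mem_of_mem_erase h)
  have hT : insert j ((c.opt b A).erase i) ≠ c.opt b A := by
    intro h
    exact hj (h ▸ Finset.mem_insert_self _ _)
  have h1 := c.surplus_ne_top b ((c.opt b A).erase i)
  have h2 := surplus_ne_bot_of_subset_opt (Finset.erase_subset i (c.opt b A))
  have hins : insert j ((c.opt b A).erase i) ⊆ A :=
    Finset.insert_subset hjA ((Finset.erase_subset _ _).trans (c.opt_subset b A))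
  have hopt := (c.isOptimal_opt b A).2.2 _ hins hind hT
  rw [c.surplus_insert b hjE] at hopt
  conv at hopt => enter [1, 2]; rw [c.surplus_eq_add_erase b hi]
  conv at hopt => enter [2, 1, 2]; rw [c.surplus_eq_add_erase b hi]
  rcases hji with hlt | ⟨heq, hid⟩
  · have h3 := EReal.add_lt_add_of_lt_of_le' hlt (le_refl (c.surplus b ((c.opt b A).erase i))) h2
      (fun h => absurd h h1)
    rcases hopt with h4 | h4
    · exact lt_asymm h3 h4
    · exact h3.ne' h4.1
  · rcases hopt with h4 | ⟨-, a, haS, haT, ha⟩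
    · rw [heq] at h4; exact lt_irrefl _ h4
    · have hai : a = i := by
        by_contra hne
        exact haT (Finset.mem_insert_of_mem (Finset.mem_erase.2 ⟨hne, haS⟩))
      subst hai
      exact lt_asymm hid (ha j (Finset.mem_insert_self _ _) hj)

open Classical in
-- Adding a bidder of nonnegative virtual value loses no surplus, and on a tie a set never precedes
-- a proper superset.
theorem not_indep_insert {i : ι} (hi : i ∉ c.opt b A) (hiA : i ∈ A)
    (h0 : 0 ≤ (c.dist i).virtualValue (b i)) :
    ¬ c.feasible.Indep (insert i (c.opt b A) : Finset ι) := by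
  intro hind
  have hopt := (c.isOptimal_opt b A).2.2 _ (Finset.insert_subset hiA (c.opt_subset b A)) hind
    (fun h => hi (h ▸ Finset.mem_insert_self _ _))
  rw [c.surplus_insert b hi] at hopt
  have hle : c.surplus b (c.opt b A) ≤
      (c.dist i).virtualValue (b i) + c.surplus b (c.opt b A) := le_add_of_nonneg_left h0
  rcases hopt with h1 | ⟨-, a, haS, haT, ha⟩
  · exact absurd hle (not_le.2 h1)
  · exact haT (Finset.mem_insert_of_mem haS)

theorem mem_closure_opt {i : ι} (hiA : i ∈ A) (hiE : i ∈ c.feasible.E)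
    (h0 : 0 ≤ (c.dist i).virtualValue (b i)) : i ∈ c.feasible.closure (c.opt b A) := by
  classical
  by_cases hi : i ∈ c.opt b A
  · exact c.feasible.mem_closure_of_mem' hi hiE
  · by_contra hcl
    refine not_indep_insert hi hiA h0 ?_
    rw [Finset.coe_insert]
    exact ((c.opt_indep b A).notMem_closure_iff hiE).1 hcl |>.1

/-- The allocated set is the output of the greedy algorithm. -/
theorem mem_opt_iff {i : ι} : i ∈ c.opt b A ↔ i ∈ A ∧ i ∈ c.feasible.E ∧
    0 ≤ (c.dist i).virtualValue (b i) ∧ i ∉ c.feasible.closure {j | j ∈ A ∧ c.Better b j i} := by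
  classical
  have hind := c.opt_indep b A
  constructor
  · intro hi
    have hiE : i ∈ c.feasible.E := hind.subset_ground hi
    refine ⟨c.opt_subset b A hi, hiE, virtualValue_nonneg_of_mem_opt hi, fun hcl => ?_⟩
    -- Every better revealed bid lies in the closure of the other winners: otherwise it could
    -- replace i.
    refine hind.notMem_closure_sdiff_of_mem (e := i) hi ?_
    rw [← Matroid.closure_inter_ground] at hcl
    refine c.feasible.closure_subset_closure_of_subset_closure ?_ hcl
    rintro j ⟨⟨hjA, hj⟩, hjE⟩
    have hji : j ≠ i := by
      rintro rfl
      rcases hj with h | h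
      exacts [lt_irrefl _ h, lt_irrefl _ h.2]
    by_cases hjS : j ∈ c.opt b A
    · exact c.feasible.mem_closure_of_mem' ⟨hjS, hji⟩ hjE
    · by_contra hn
      refine not_indep_exchange hi hjS hjA hj ?_
      rw [Finset.coe_insert, Finset.coe_erase]
      exact (((hind.subset Set.sdiff_subset).notMem_closure_iff hjE).1 hn).1
  · rintro ⟨hiA, hiE, h0, hcl⟩
    by_contra hi
    have hmem := mem_closure_opt hiA hiE h0 (b := b)
    -- If i lost, every other element of its fundamental circuit would be better than i, since
    -- otherwise i could replace it; then better bids would span i.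
    have hC := hind.fundCircuit_isCircuit hmem hi
    apply hcl
    refine c.feasible.closure_subset_closure ?_
      (hC.mem_closure_sdiff_singleton_of_mem (c.feasible.mem_fundCircuit i _))
    rintro j ⟨hjC, hji : j ≠ i⟩
    have hjS : j ∈ c.opt b A := by
      rcases c.feasible.fundCircuit_subset_insert i _ hjC with h | h
      exacts [absurd h hji, h]
    refine ⟨c.opt_subset b A hjS, ?_⟩
    rcases better_or_better (c := c) (b := b) (Ne.symm hji) with h | h
    · exact h
    · exfalso
      refine not_indep_exchange hjS hi hiA h ?_
      rw [hind.mem_fundCircuit_iff hmem hi] at hjC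
      rw [Finset.coe_insert, Finset.coe_erase]
      rwa [Set.insert_sdiff_singleton_comm hji.symm]

/-- Hiding bids shrinks the set of better bids, hence its closure. -/
theorem opt_mono_revealed {A' : Finset ι} (hA : A' ⊆ A) {i : ι} (hiA : i ∈ A')
    (hi : i ∈ c.opt b A) : i ∈ c.opt b A' := by
  rw [mem_opt_iff] at hi ⊢
  refine ⟨hiA, hi.2.1, hi.2.2.1, fun h => hi.2.2.2 (c.feasible.closure_subset_closure ?_ h)⟩
  exact fun j hj => ⟨hA hj.1, hj.2⟩

/-- The new winners lie in the closure of the old ones, so they are not more numerous; all old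
winners still revealed are kept. Thus new winners can only take the places of hidden ones. -/
theorem card_opt_sdiff_le [DecidableEq ι] {A' : Finset ι} (hA : A' ⊆ A) :
    (c.opt b A' \ c.opt b A).card ≤ (A \ A').card := by
  have h1 : (c.opt b A').card ≤ (c.opt b A).card := by
    have hsub : (c.opt b A' : Set ι) ⊆ c.feasible.closure (c.opt b A) := fun i hi => by
      have hi := mem_opt_iff.1 hi
      exact mem_closure_opt (hA hi.1) hi.2.1 hi.2.2.1
    have h2 := (c.opt_indep b A').encard_le_eRk_of_subset hsub
    rw [Matroid.eRk_closure_eq, (c.opt_indep b A).eRk_eq_encard] at h2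
    simpa using h2
  have h2 : c.opt b A ∩ A' ⊆ c.opt b A' ∩ c.opt b A := fun i hi => by
    rw [Finset.mem_inter] at hi ⊢
    exact ⟨opt_mono_revealed hA hi.2 hi.1, hi.1⟩
  have h3 := Finset.card_le_card h2
  have h4 := Finset.card_sdiff_add_card_inter (c.opt b A') (c.opt b A)
  have h5 := Finset.card_sdiff_add_card_inter (c.opt b A) A'
  have h6 : (c.opt b A \ A').card ≤ (A \ A').card :=
    Finset.card_le_card (Finset.sdiff_subset_sdiff (c.opt_subset b A) le_rfl)
  omega

theorem mem_opt_update_of_le [DecidableEq ι] (hreg : ∀ i, (c.dist i).Regular) {i : ι} {x y : ℝ}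
    (hxy : x ≤ y)
    (hi : i ∈ c.opt (Function.update b i x) A) : i ∈ c.opt (Function.update b i y) A := by
  rw [mem_opt_iff] at hi ⊢
  have hmono := hreg i hxy
  simp only [Function.update_self] at hi ⊢
  refine ⟨hi.1, hi.2.1, hi.2.2.1.trans hmono,
    fun h => hi.2.2.2 (c.feasible.closure_subset_closure ?_ h)⟩
  rintro j ⟨hjA, hj⟩
  refine ⟨hjA, ?_⟩
  by_cases hji : j = i
  · subst hji
    rcases hj with h | h
    exacts [absurd h (lt_irrefl _), absurd h.2 (lt_irrefl _)]
  · simp only [Better, Function.update_self, Function.update_of_ne hji] at hj ⊢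
    rcases hj with h | h
    · exact Or.inl (hmono.trans_lt h)
    · rcases hmono.lt_or_eq with h' | h'
      · exact Or.inl (h.1 ▸ h')
      · exact Or.inr ⟨h'.trans h.1, h.2⟩

/-- The bid of an unallocated bidder does not affect the allocation when it is lowered below `0`. -/
theorem opt_update_of_notMem [DecidableEq ι] {i : ι} (hi : i ∉ c.opt b A) {x : ℝ}
    (hx : x < 0) :
    c.opt (Function.update b i x) A = c.opt b A := by
  have hsur : ∀ T : Finset ι, i ∉ T → c.surplus (Function.update b i x) T = c.surplus b T := by
    intro T hT
    refine Finset.sum_congr rfl fun j hj => ?_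
    rw [Function.update_of_ne (ne_of_mem_of_not_mem hj hT)]
  refine (c.isOptimal_opt _ _).eq ⟨c.opt_subset b A, c.opt_indep b A, fun T hTA hT hne => ?_⟩
  by_cases hiT : i ∈ T
  · left
    rw [hsur _ hi, c.surplus_eq_add_erase _ hiT, Function.update_self,
      (c.dist i).virtualValue_of_neg hx, EReal.bot_add]
    exact lt_of_lt_of_le (EReal.bot_lt_zero) (c.surplus_opt_nonneg b A)
  · rw [hsur _ hi, hsur _ hiT]
    exact (c.isOptimal_opt b A).2.2 T hTA hT hne

theorem bid_nonneg_of_mem_opt {i : ι} (hi : i ∈ c.opt b A) : 0 ≤ b i := by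
  by_contra! h
  have := virtualValue_nonneg_of_mem_opt hi
  rw [(c.dist i).virtualValue_of_neg h] at this
  simp at this

end Contract
-- Tail integrals and integration by parts
namespace ValueDist

open Set

variable {α : ℝ} (D : ValueDist)

theorem measurable_coe_pdf : Measurable fun v => (D.pdf v : ℝ≥0∞) :=
  D.measurable_pdf.coe_nnreal_ennreal

theorem law_absolutelyContinuous : D.law ≪ volume := withDensity_absolutelyContinuous _ _

theorem law_singleton (v : ℝ) : D.law {v} = 0 :=
  D.law_absolutelyContinuous (measure_singleton v)

theorem law_Iio_zero : D.law (Iio 0) = 0 := by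
  rw [law, withDensity_apply _ measurableSet_Iio]
  refine (setLIntegral_congr_fun measurableSet_Iio (g := fun _ => 0) ?_).trans (by simp)
  intro x hx
  simp [D.pdf_of_neg x hx]

theorem law_Ioi_zero : D.law (Ioi 0) = 1 := by
  have h1 : D.law (Iic 0) = 0 := by
    rw [← Iio_union_right]
    exact measure_union_null D.law_Iio_zero (D.law_singleton 0)
  have h2 := prob_compl_eq_one_sub (μ := D.law) (measurableSet_Iic (a := (0 : ℝ)))
  rwa [compl_Iic, h1, tsub_zero] at h2

theorem setLIntegral_law {f : ℝ → ℝ≥0∞} (hf : Measurable f) {s : Set ℝ} (hs : MeasurableSet s) :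
    ∫⁻ x in s, f x ∂D.law = ∫⁻ x in s, D.pdf x * f x := by
  rw [law, setLIntegral_withDensity_eq_setLIntegral_mul _ D.measurable_coe_pdf hf hs]
  rfl

theorem antitone_tail : Antitone fun t => D.law (Ioi t) :=
  fun _ _ h => measure_mono (Ioi_subset_Ioi h)

theorem measurable_tail : Measurable fun t => D.law (Ioi t) := D.antitone_tail.measurable

/-- Tonelli on the region t < x. -/
theorem lintegral_setLIntegral_Iio {W : ℝ → ℝ≥0∞} (hW : Measurable W) (s : Set ℝ) :
    ∫⁻ x, (∫⁻ t in s ∩ Iio x, W t) ∂D.law = ∫⁻ t in s, W t * D.law (Ioi t) := by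
  have hm : MeasurableSet {z : ℝ × ℝ | z.2 < z.1} := measurableSet_lt measurable_snd measurable_fst
  have h1 : ∀ x, ∫⁻ t in s ∩ Iio x, W t =
      ∫⁻ t in s, {z : ℝ × ℝ | z.2 < z.1}.indicator (fun z => W z.2) (x, t) := fun x => by
    rw [inter_comm, ← Measure.restrict_restrict measurableSet_Iio,
      ← lintegral_indicator measurableSet_Iio]
    rfl
  simp_rw [h1]
  rw [lintegral_lintegral_swap
    (f := fun x t => {z : ℝ × ℝ | z.2 < z.1}.indicator (fun z => W z.2) (x, t))
    ((hW.comp measurable_snd).indicator hm).aemeasurable]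
  refine lintegral_congr fun t => ?_
  have h2 : ∀ x, {z : ℝ × ℝ | z.2 < z.1}.indicator (fun z => W z.2) (x, t) =
      (Ioi t).indicator (fun _ => W t) x := fun x => rfl
  simp_rw [h2]
  rw [lintegral_indicator measurableSet_Ioi, setLIntegral_const]

theorem lintegral_deriv_Ioc {w w' : ℝ → ℝ} {u v : ℝ} (huv : u ≤ v)
    (hw : ∀ t ∈ Icc u v, HasDerivAt w (w' t) t) (hc : ContinuousOn w' (Icc u v))
    (h0 : ∀ t ∈ Icc u v, 0 ≤ w' t) :
    ∫⁻ t in Ioc u v, ENNReal.ofReal (w' t) = ENNReal.ofReal (w v - w u) := by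
  have hint : IntervalIntegrable w' volume u v := by
    refine ContinuousOn.intervalIntegrable ?_
    rwa [uIcc_of_le huv]
  rw [← intervalIntegral.integral_eq_sub_of_hasDerivAt (by rwa [uIcc_of_le huv]) hint,
    intervalIntegral.integral_of_le huv, ofReal_integral_eq_lintegral_ofReal hint.1]
  filter_upwards [self_mem_ae_restrict measurableSet_Ioc] with t ht
  exact h0 t (Ioc_subset_Icc_self ht)

/-- Integration by parts against the law of the value. -/
theorem lintegral_by_parts {w w' : ℝ → ℝ} {u v : ℝ} (huv : u ≤ v)
    (hw : ∀ t ∈ Icc u v, HasDerivAt w (w' t) t) (hc : ContinuousOn w' (Icc u v))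
    (hm' : Measurable w')
    (h0 : ∀ t ∈ Icc u v, 0 ≤ w' t) (hu : 0 ≤ w u) :
    ENNReal.ofReal (w v) * D.law (Ioi v) + ∫⁻ x in Ioc u v, ENNReal.ofReal (w x) ∂D.law =
      ENNReal.ofReal (w u) * D.law (Ioi u) +
        ∫⁻ t in Ioc u v, ENNReal.ofReal (w' t) * D.law (Ioi t) := by
  have hinc : ∀ x ∈ Icc u v, ENNReal.ofReal (w u) + ∫⁻ t in Ioc u x, ENNReal.ofReal (w' t) =
      ENNReal.ofReal (w x) := by
    intro x hx
    have hsub : Icc u x ⊆ Icc u v := Icc_subset_Icc_right hx.2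
    have hle : 0 ≤ w x - w u := by
      have : MonotoneOn w (Icc u v) :=
        monotoneOn_of_deriv_nonneg (convex_Icc u v)
          (fun t ht => (hw t ht).continuousAt.continuousWithinAt)
          (fun t ht => (hw t (interior_subset ht)).differentiableAt.differentiableWithinAt)
          (fun t ht => by
            rw [(hw t (interior_subset ht)).deriv]; exact h0 t (interior_subset ht))
      exact sub_nonneg.2 (this (left_mem_Icc.2 huv) hx hx.1)
    rw [lintegral_deriv_Ioc hx.1 (fun t ht => hw t (hsub ht)) (hc.mono hsub)
      (fun t ht => h0 t (hsub ht)), ← ENNReal.ofReal_add hu hle]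
    congr 1; ring
  -- Both sides are the integral of w(min(x, v)) over x > u: the left splits it at v, the right
  -- writes w as w(u) plus the integral of w'.
  rw [← D.lintegral_setLIntegral_Iio hm'.ennreal_ofReal]
  have hsupp : ∫⁻ x, (∫⁻ t in Ioc u v ∩ Iio x, ENNReal.ofReal (w' t)) ∂D.law =
      ∫⁻ x in Ioi u, (∫⁻ t in Ioc u v ∩ Iio x, ENNReal.ofReal (w' t)) ∂D.law := by
    rw [← lintegral_indicator measurableSet_Ioi]
    refine lintegral_congr fun x => ?_
    by_cases hx : x ∈ Ioi u
    · rw [indicator_of_mem hx]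
    · rw [indicator_of_notMem hx]
      have : Ioc u v ∩ Iio x = ∅ := by
        ext t
        simp only [mem_Ioi, not_lt] at hx
        simp only [mem_inter_iff, mem_Ioc, mem_Iio, mem_empty_iff_false, iff_false]
        rintro ⟨⟨h1, -⟩, h2⟩
        linarith
      rw [this]; simp
  rw [hsupp, ← setLIntegral_const, ← setLIntegral_const, ← lintegral_add_left measurable_const,
    ← Ioc_union_Ioi_eq_Ioi huv, lintegral_union measurableSet_Ioi
      (Set.disjoint_left.2 fun x hx hx' => absurd hx.2 (not_le.2 hx')), add_comm]
  congr 1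
  · refine setLIntegral_congr_fun measurableSet_Ioc fun x hx => ?_
    have : Ioc u v ∩ Iio x = Ioo u x := by
      ext t
      simp only [mem_inter_iff, mem_Ioc, mem_Iio, mem_Ioo]
      exact ⟨fun h => ⟨h.1.1, h.2⟩, fun h => ⟨⟨h.1, (h.2.trans_le hx.2).le⟩, h.2⟩⟩
    simp only [this]
    rw [setLIntegral_congr Ioo_ae_eq_Ioc, hinc x (Ioc_subset_Icc_self hx)]
  · refine setLIntegral_congr_fun measurableSet_Ioi fun x hx => ?_
    have : Ioc u v ∩ Iio x = Ioc u v := by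
      refine inter_eq_left.2 fun t ht => ?_
      exact lt_of_le_of_lt ht.2 hx
    simp only [this]
    rw [hinc v (right_mem_Icc.2 huv)]

/-- The positive part of the virtual value. -/
noncomputable def posVirtual (v : ℝ) : ℝ≥0∞ := (D.virtualValue v).toENNReal

theorem posVirtual_eq (v : ℝ) :
    D.posVirtual v = ENNReal.ofReal v - D.law (Ioi v) / D.pdf v := by
  rw [posVirtual, virtualValue, EReal.toENNReal_sub (EReal.coe_ennreal_nonneg _),
    EReal.toENNReal_coe, EReal.real_coe_toENNReal]

theorem measurable_invHazard : Measurable fun v => D.law (Ioi v) / (D.pdf v : ℝ≥0∞) :=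
  D.measurable_tail.div D.measurable_coe_pdf

theorem measurable_posVirtual : Measurable D.posVirtual := by
  have : D.posVirtual = fun v => ENNReal.ofReal v - D.law (Ioi v) / D.pdf v :=
    funext D.posVirtual_eq
  rw [this]
  exact ENNReal.measurable_ofReal.sub D.measurable_invHazard

theorem invHazard_le_of_le_virtualValue {v a : ℝ} (h : (a : EReal) ≤ D.virtualValue v) :
    D.law (Ioi v) / D.pdf v ≤ ENNReal.ofReal (v - a) := by
  unfold virtualValue at h
  generalize D.law (Ioi v) / (D.pdf v : ℝ≥0∞) = x at *
  induction x with
  | top => simp at h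
  | coe x =>
    have h' : (a : EReal) ≤ ((v - x : ℝ) : EReal) := h
    rw [EReal.coe_le_coe_iff] at h'
    rw [← ENNReal.ofReal_coe_nnreal]
    exact ENNReal.ofReal_le_ofReal (by linarith)

/-- Where the density is zero, finiteness of the quotient forces the tail to vanish. -/
theorem tail_le_mul_pdf {v a : ℝ} (h : D.law (Ioi v) / D.pdf v ≤ ENNReal.ofReal a) :
    D.law (Ioi v) ≤ D.pdf v * ENNReal.ofReal a := by
  by_cases h0 : D.pdf v = 0
  · by_cases h1 : D.law (Ioi v) = 0
    · simp [h1]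
    · rw [h0, ENNReal.coe_zero, ENNReal.div_zero h1] at h
      simp at h
  · rw [mul_comm]
    exact (ENNReal.div_le_iff (by simpa using h0) (by simp)).1 h

/-! ### Posted-price revenue and virtual surplus -/

section Myerson

theorem setLIntegral_Ioi_ofReal {p : ℝ} (hp : 0 ≤ p) :
    ∫⁻ x in Ioi p, ENNReal.ofReal x ∂D.law =
      ENNReal.ofReal p * D.law (Ioi p) + ∫⁻ t in Ioi p, D.law (Ioi t) := by
  have h1 := D.lintegral_setLIntegral_Iio (W := fun _ => 1) measurable_const (Ioi p)
  simp only [one_mul, setLIntegral_one, Ioi_inter_Iio, Real.volume_Ioo] at h1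
  have h2 : ∫⁻ x, ENNReal.ofReal (x - p) ∂D.law = ∫⁻ x in Ioi p, ENNReal.ofReal (x - p) ∂D.law := by
    rw [← lintegral_indicator measurableSet_Ioi]
    refine lintegral_congr fun x => ?_
    by_cases hx : x ∈ Ioi p
    · rw [indicator_of_mem hx]
    · rw [indicator_of_notMem hx]
      simpa using hx
  rw [← h1, h2, ← setLIntegral_const, ← lintegral_add_left measurable_const]
  refine setLIntegral_congr_fun measurableSet_Ioi fun x hx => ?_
  rw [← ENNReal.ofReal_add hp (by simpa using hx.le)]
  congr 1; ring

/-- Only an inequality, because the density may vanish where the tail does not. -/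
theorem setLIntegral_invHazard_le (p : ℝ) :
    ∫⁻ x in Ioi p, D.law (Ioi x) / D.pdf x ∂D.law ≤ ∫⁻ t in Ioi p, D.law (Ioi t) := by
  rw [D.setLIntegral_law D.measurable_invHazard measurableSet_Ioi]
  exact lintegral_mono fun x => ENNReal.mul_div_le

/-- The revenue of a posted price is at most the virtual surplus of the values above it. -/
theorem price_mul_tail_le {p : ℝ} (hp : 0 ≤ p) (hfin : ∫⁻ t in Ioi p, D.law (Ioi t) ≠ ∞) :
    ENNReal.ofReal p * D.law (Ioi p) ≤ ∫⁻ x in Ioi p, D.posVirtual x ∂D.law := by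
  -- Adding the finite tail integral turns the left side into the expectation of x on x > p, and
  -- avoids subtraction.
  refine (ENNReal.add_le_add_iff_right hfin).1 ?_
  rw [← D.setLIntegral_Ioi_ofReal hp]
  calc ∫⁻ x in Ioi p, ENNReal.ofReal x ∂D.law
      ≤ ∫⁻ x in Ioi p, (D.posVirtual x + D.law (Ioi x) / D.pdf x) ∂D.law :=
        lintegral_mono fun x => by rw [D.posVirtual_eq]; exact le_tsub_add
    _ = ∫⁻ x in Ioi p, D.posVirtual x ∂D.law + ∫⁻ x in Ioi p, D.law (Ioi x) / D.pdf x ∂D.law :=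
        lintegral_add_left D.measurable_posVirtual _
    _ ≤ _ := add_le_add_right (D.setLIntegral_invHazard_le p) _

/-- Converse of the posted-price bound: nonnegative virtual values above p make the truncated
subtraction exact, and let the density vanish only where the tail does. -/
theorem setLIntegral_posVirtual_le {p : ℝ} (hp : 0 ≤ p)
    (hfin : ∫⁻ t in Ioi p, D.law (Ioi t) ≠ ∞) (hφ : ∀ x, p < x → 0 ≤ D.virtualValue x) :
    ∫⁻ x in Ioi p, D.posVirtual x ∂D.law ≤ ENNReal.ofReal p * D.law (Ioi p) := by
  refine (ENNReal.add_le_add_iff_right hfin).1 ?_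
  have hle : ∀ x, p < x → D.law (Ioi x) / D.pdf x ≤ ENNReal.ofReal x := fun x hx => by
    simpa using D.invHazard_le_of_le_virtualValue (a := 0) (by simpa using hφ x hx)
  calc ∫⁻ x in Ioi p, D.posVirtual x ∂D.law + ∫⁻ t in Ioi p, D.law (Ioi t)
      ≤ ∫⁻ x in Ioi p, D.posVirtual x ∂D.law +
          ∫⁻ x in Ioi p, D.law (Ioi x) / D.pdf x ∂D.law := by
        rw [D.setLIntegral_law D.measurable_invHazard measurableSet_Ioi]
        refine add_le_add_right ?_ _
        refine setLIntegral_mono' measurableSet_Ioi fun x hx => ?_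
        rw [ENNReal.mul_div_cancel' (fun h0 => ?_) (by simp)]
        have := D.tail_le_mul_pdf (hle x hx)
        rw [h0] at this
        simpa using this
    _ = ∫⁻ x in Ioi p, (D.posVirtual x + D.law (Ioi x) / D.pdf x) ∂D.law :=
        (lintegral_add_left D.measurable_posVirtual _).symm
    _ = ∫⁻ x in Ioi p, ENNReal.ofReal x ∂D.law := by
        refine setLIntegral_congr_fun measurableSet_Ioi fun x hx => ?_
        simp only [D.posVirtual_eq]
        exact tsub_add_cancel_of_le (hle x hx)
    _ = _ := D.setLIntegral_Ioi_ofReal hp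

end Myerson

/-! ### Tail bounds under strong regularity -/

namespace StronglyRegular

variable {D}

theorem regular (h : D.StronglyRegular α) (hα : 0 ≤ α) : D.Regular := fun v w hvw => by
  refine le_trans ?_ (h hvw)
  refine le_add_of_nonneg_right ?_
  exact_mod_cast mul_nonneg hα (sub_nonneg.2 hvw)

/-- The virtual value is finite where the density is positive, and from there it grows at slope at
least α. So the reserve is a genuine supremum. -/
theorem bddAbove (h : D.StronglyRegular α) (hα : 0 < α) :
    BddAbove {v : ℝ | D.virtualValue v < 0} := by
  obtain ⟨v₀, hv₀⟩ : ∃ v, D.pdf v ≠ 0 := by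
    by_contra! h0
    have := D.lintegral_pdf
    simp [h0] at this
  have hfin : D.law (Ioi v₀) / D.pdf v₀ ≠ ∞ :=
    ENNReal.div_ne_top (measure_ne_top _ _) (by simpa using hv₀)
  obtain ⟨y, hy⟩ : ∃ y : ℝ, D.virtualValue v₀ = y := by
    refine ⟨v₀ - (D.law (Ioi v₀) / D.pdf v₀).toReal, ?_⟩
    rw [virtualValue, EReal.coe_sub, EReal.coe_ennreal_toReal hfin]
  refine ⟨v₀ + |y| / α, fun v hv => ?_⟩
  by_contra! hlt
  have hpos : 0 ≤ |y| / α := by positivity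
  have h1 := h (show v₀ ≤ v by linarith)
  have h2 := h1.trans_lt hv
  rw [hy] at h2
  have h3 : y + α * (v - v₀) < 0 := by exact_mod_cast h2
  have h4 : |y| < α * (v - v₀) := by
    rw [mul_comm, ← div_lt_iff₀ hα]; linarith
  linarith [neg_abs_le y]

theorem reserve_nonneg (h : D.StronglyRegular α) (hα : 0 < α) : 0 ≤ D.reserve := by
  refine le_of_forall_lt fun x hx => ?_
  refine lt_of_lt_of_le (b := x / 2) (by linarith) (le_csSup (h.bddAbove hα) ?_)
  simp [D.virtualValue_of_neg (show x / 2 < 0 by linarith)]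

theorem virtualValue_nonneg (h : D.StronglyRegular α) (hα : 0 < α) {v : ℝ} (hv : D.reserve < v) :
    0 ≤ D.virtualValue v := 
  not_lt.1 fun hlt => absurd (le_csSup (h.bddAbove hα) (mem_ofPred.2 hlt)) (not_le.2 hv)

theorem le_virtualValue (h : D.StronglyRegular α) (hα : 0 < α) {v : ℝ} (hv : D.reserve < v) :
    ((α * (v - D.reserve) : ℝ) : EReal) ≤ D.virtualValue v := by
  have h0 := h.virtualValue_nonneg hα hv
  obtain ⟨y, hy⟩ : ∃ y : ℝ, D.virtualValue v = y :=
    ⟨(D.virtualValue v).toReal, (EReal.coe_toReal (D.virtualValue_ne_top v)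
      (ne_bot_of_le_ne_bot (by simp) h0)).symm⟩
  rw [hy] at h0 ⊢
  have h0 : 0 ≤ y := by exact_mod_cast h0
  rw [EReal.coe_le_coe_iff]
  by_contra! hlt
  -- Since φ may jump at the reserve, the comparison point is v - m/α, still above the reserve.
  -- There φ ≥ 0, so φ(v) ≥ m, while m lies strictly above y = φ(v).
  set m := (y + α * (v - D.reserve)) / 2 with hm
  have h1 : m / α < v - D.reserve := by rw [div_lt_iff₀ hα]; linarith
  have h2 : 0 < m / α := div_pos (by linarith) hα
  have h3 := h (show v - m / α ≤ v by linarith)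
  have h4 := (le_add_of_nonneg_left
    (h.virtualValue_nonneg hα (show D.reserve < v - m / α by linarith))).trans h3
  rw [hy, EReal.coe_le_coe_iff] at h4
  have : α * (v - (v - m / α)) = m := by field_simp; ring
  linarith

/-- The upper bound `α r + (1 - α) v` on the inverse hazard rate at `v`. -/
theorem tail_le (h : D.StronglyRegular α) (hα : 0 < α) {v : ℝ} (hv : D.reserve < v) :
    D.law (Ioi v) ≤ D.pdf v * ENNReal.ofReal (α * D.reserve + (1 - α) * v) := by
  have := D.tail_le_mul_pdf (D.invHazard_le_of_le_virtualValue (h.le_virtualValue hα hv))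
  convert this using 3
  ring

/-- With L(t) = αr + (1-α)t and γ = 1/(1-α), the derivative of L^γ is L^{γ-1}, and `tail_le` gives
L^{γ-1}(1-F) ≤ L^γ g. Hence L^γ(1-F) does not increase; integration by parts replaces
differentiation of F. -/
theorem rpow_mul_tail_le (h : D.StronglyRegular α) (hα : 0 < α) (hα1 : α < 1) {u v : ℝ}
    (hu : D.reserve ≤ u) (hu0 : 0 < u) (huv : u ≤ v) :
    ENNReal.ofReal ((α * D.reserve + (1 - α) * v) ^ (1 / (1 - α))) * D.law (Ioi v) ≤
      ENNReal.ofReal ((α * D.reserve + (1 - α) * u) ^ (1 / (1 - α))) * D.law (Ioi u) := by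
  set r := D.reserve
  have hr : 0 ≤ r := h.reserve_nonneg hα
  set γ := 1 / (1 - α) with hγ
  have hα' : 0 < 1 - α := by linarith
  have hγ' : γ * (1 - α) = 1 := by rw [hγ]; field_simp
  have hpos : ∀ t, u ≤ t → 0 < α * r + (1 - α) * t := fun t ht => by
    have : 0 < (1 - α) * t := mul_pos hα' (hu0.trans_le ht)
    positivity
  have hderiv : ∀ t ∈ Icc u v, HasDerivAt (fun t => (α * r + (1 - α) * t) ^ γ)
      ((α * r + (1 - α) * t) ^ (γ - 1)) t := fun t ht => by
    have h1 : HasDerivAt (fun t => α * r + (1 - α) * t) (1 - α) t := by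
      simpa using ((hasDerivAt_id t).const_mul (1 - α)).const_add (α * r)
    convert h1.rpow_const (p := γ) (Or.inl (hpos t ht.1).ne') using 1
    linear_combination (-(α * r + (1 - α) * t) ^ (γ - 1)) * hγ'
  have hparts := D.lintegral_by_parts huv hderiv
    (fun t ht => by
      refine ContinuousAt.continuousWithinAt ?_
      exact ContinuousAt.rpow_const (by fun_prop) (Or.inl (hpos t ht.1).ne'))
    (by fun_prop) (fun t ht => (Real.rpow_pos_of_pos (hpos t ht.1) _).le)
    (Real.rpow_pos_of_pos (hpos u le_rfl) _).le
  have hle : ∫⁻ t in Ioc u v, ENNReal.ofReal ((α * r + (1 - α) * t) ^ (γ - 1)) * D.law (Ioi t) ≤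
      ∫⁻ x in Ioc u v, ENNReal.ofReal ((α * r + (1 - α) * x) ^ γ) ∂D.law := by
    rw [D.setLIntegral_law (by fun_prop) measurableSet_Ioc]
    refine setLIntegral_mono' measurableSet_Ioc fun t ht => ?_
    refine (mul_le_mul_right (h.tail_le hα (hu.trans_lt ht.1)) _).trans_eq ?_
    rw [← mul_assoc, mul_comm _ (D.pdf t : ℝ≥0∞), mul_assoc,
      ← ENNReal.ofReal_mul (Real.rpow_pos_of_pos (hpos t ht.1.le) _).le]
    congr 2
    rw [Real.rpow_sub_one (hpos t ht.1.le).ne', div_mul_cancel₀ _ (hpos t ht.1.le).ne']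
  have hfin : ∫⁻ x in Ioc u v, ENNReal.ofReal ((α * r + (1 - α) * x) ^ γ) ∂D.law ≠ ∞ := by
    refine ne_top_of_le_ne_top (b := ENNReal.ofReal ((α * r + (1 - α) * v) ^ γ) * D.law (Ioc u v))
      (ENNReal.mul_ne_top (by simp) (measure_ne_top _ _)) ?_
    rw [← setLIntegral_const]
    refine setLIntegral_mono' measurableSet_Ioc fun t ht => ENNReal.ofReal_le_ofReal ?_
    refine Real.rpow_le_rpow (hpos t ht.1.le).le ?_ (by positivity)
    have := mul_le_mul_of_nonneg_left ht.2 hα'.le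
    linarith
  refine (ENNReal.add_le_add_iff_right hfin).1 ?_
  rw [hparts]
  gcongr

/-- The same argument with weight L: formally (L(1-F))' = (1-α)(1-F) - Lg ≤ -α(1-F). -/
theorem mul_setLIntegral_tail_add_le (h : D.StronglyRegular α) (hα : 0 < α) (hα1 : α < 1) {u v : ℝ}
    (hu : D.reserve ≤ u) (huv : u ≤ v) :
    ENNReal.ofReal α * (∫⁻ t in Ioc u v, D.law (Ioi t)) +
        ENNReal.ofReal (α * D.reserve + (1 - α) * v) * D.law (Ioi v) ≤
      ENNReal.ofReal (α * D.reserve + (1 - α) * u) * D.law (Ioi u) := by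
  set r := D.reserve
  have hr : 0 ≤ r := h.reserve_nonneg hα
  have hα' : 0 < 1 - α := by linarith
  have hpos : ∀ t, u ≤ t → 0 ≤ α * r + (1 - α) * t := fun t ht => by
    have : 0 ≤ (1 - α) * t := mul_nonneg hα'.le (hr.trans (hu.trans ht))
    positivity
  have hderiv : ∀ t ∈ Icc u v, HasDerivAt (fun t => α * r + (1 - α) * t)
      ((fun _ => 1 - α) t) t := fun t _ => by
    simpa using ((hasDerivAt_id t).const_mul (1 - α)).const_add (α * r)
  have hparts := D.lintegral_by_parts huv hderiv (by fun_prop) (by fun_prop)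
    (fun t _ => hα'.le) (hpos u le_rfl)
  rw [lintegral_const_mul _ D.measurable_tail] at hparts
  have hle : ∫⁻ t in Ioc u v, D.law (Ioi t) ≤
      ∫⁻ x in Ioc u v, ENNReal.ofReal (α * r + (1 - α) * x) ∂D.law := by
    rw [D.setLIntegral_law (by fun_prop) measurableSet_Ioc]
    exact setLIntegral_mono' measurableSet_Ioc fun t ht => h.tail_le hα (hu.trans_lt ht.1)
  have hfin : ENNReal.ofReal (1 - α) * ∫⁻ t in Ioc u v, D.law (Ioi t) ≠ ∞ := by
    refine ENNReal.mul_ne_top (by simp) (ne_top_of_le_ne_top (b := 1 * volume (Ioc u v)) ?_ ?_)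
    · simp
    · rw [← setLIntegral_const]
      exact lintegral_mono fun t => prob_le_one
  refine (ENNReal.add_le_add_iff_right hfin).1 ?_
  rw [← hparts, add_right_comm, ← add_mul, ← ENNReal.ofReal_add hα.le hα'.le, add_comm]
  simpa using add_le_add_right hle _

theorem mul_setLIntegral_Ioi_tail_le (h : D.StronglyRegular α) (hα : 0 < α) (hα1 : α < 1) {u : ℝ}
    (hu : D.reserve ≤ u) :
    ENNReal.ofReal α * ∫⁻ t in Ioi u, D.law (Ioi t) ≤
      ENNReal.ofReal (α * D.reserve + (1 - α) * u) * D.law (Ioi u) := by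
  have hU : Ioi u = ⋃ k : ℕ, Ioc u (u + k) := by
    ext x
    simp only [mem_Ioi, mem_iUnion, mem_Ioc]
    refine ⟨fun hx => ?_, fun ⟨k, hk⟩ => hk.1⟩
    obtain ⟨k, hk⟩ := exists_nat_ge (x - u)
    exact ⟨k, hx, by linarith⟩
  have hdir : Directed (· ⊆ ·) fun k : ℕ => Ioc u (u + k) := by
    refine Monotone.directed_le fun k l hkl => Ioc_subset_Ioc_right ?_
    have : (k : ℝ) ≤ l := by exact_mod_cast hkl
    linarith
  conv_lhs => rw [hU]
  rw [setLIntegral_iUnion_of_directed _ hdir, ENNReal.mul_iSup]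
  refine iSup_le fun k => le_trans (le_add_right le_rfl)
    (h.mul_setLIntegral_tail_add_le hα hα1 hu (v := u + k) (by simp))

theorem setLIntegral_tail_ne_top (h : D.StronglyRegular α) (hα : 0 < α) (hα1 : α < 1) {p : ℝ}
    (hp : 0 ≤ p) : ∫⁻ t in Ioi p, D.law (Ioi t) ≠ ∞ := by
  have hr := h.reserve_nonneg hα
  have h1 : ∫⁻ t in Ioi D.reserve, D.law (Ioi t) ≠ ∞ := by
    intro htop
    have := h.mul_setLIntegral_Ioi_tail_le hα hα1 le_rfl
    rw [htop, ENNReal.mul_top (by simpa using hα), top_le_iff] at this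
    exact ENNReal.mul_ne_top (by simp) (measure_ne_top _ _) this
  have h2 : ∫⁻ t in Ioc 0 D.reserve, D.law (Ioi t) ≠ ∞ := by
    refine ne_top_of_le_ne_top (b := 1 * volume (Ioc 0 D.reserve)) (by simp) ?_
    rw [← setLIntegral_const]
    exact lintegral_mono fun t => prob_le_one
  refine ne_top_of_le_ne_top (ENNReal.add_ne_top.2 ⟨h2, h1⟩)
    (le_trans (lintegral_mono_set ?_) (lintegral_union_le _ _ _))
  rw [Ioc_union_Ioi_eq_Ioi hr]
  exact Ioi_subset_Ioi hp

theorem integrable_id (h : D.StronglyRegular α) (hα : 0 < α) (hα1 : α < 1) :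
    Integrable (fun x => x) D.law := by
  refine ⟨measurable_id.aestronglyMeasurable, ?_⟩
  rw [hasFiniteIntegral_iff_enorm]
  have h1 : ∀ᵐ x ∂D.law, ‖x‖ₑ = (Ioi 0).indicator ENNReal.ofReal x := by
    have h0 : ∀ᵐ x ∂D.law, x ∈ Ioi (0 : ℝ) :=
      (mem_ae_iff_prob_eq_one measurableSet_Ioi).2 D.law_Ioi_zero
    filter_upwards [h0] with x hx
    rw [indicator_of_mem hx, Real.enorm_eq_ofReal hx.le]
  rw [lintegral_congr_ae h1, lintegral_indicator measurableSet_Ioi,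
    D.setLIntegral_Ioi_ofReal le_rfl]
  simpa using (h.setLIntegral_tail_ne_top hα hα1 le_rfl).lt_top

/-- If the reserve were 0, the weight L(u)^{1/(1-α)} would tend to 0 as u → 0, so the monotone
product would kill every tail beyond a positive point. -/
theorem reserve_pos (h : D.StronglyRegular α) (hα : 0 < α) (hα1 : α < 1) : 0 < D.reserve := by
  refine (h.reserve_nonneg hα).lt_of_ne fun h0 => ?_
  have hα' : 0 < 1 - α := by linarith
  have hz : ∀ v > 0, D.law (Ioi v) = 0 := by
    intro v hv
    have hlim : Filter.Tendsto (fun u : ℝ => ENNReal.ofReal (((1 - α) * u) ^ (1 / (1 - α))))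
        (nhdsWithin 0 (Ioi 0)) (nhds 0) := by
      have hc : Filter.Tendsto (fun u : ℝ => ENNReal.ofReal (((1 - α) * u) ^ (1 / (1 - α))))
          (nhds 0) (nhds (ENNReal.ofReal (((1 - α) * 0) ^ (1 / (1 - α))))) := by
        refine ENNReal.tendsto_ofReal (Filter.Tendsto.rpow_const ?_ (Or.inr (by positivity)))
        exact (continuous_const.mul continuous_id).tendsto 0
      rw [mul_zero, Real.zero_rpow (by positivity), ENNReal.ofReal_zero] at hc
      exact hc.mono_left nhdsWithin_le_nhds
    have hle : ENNReal.ofReal (((1 - α) * v) ^ (1 / (1 - α))) * D.law (Ioi v) ≤ 0 := by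
      refine ge_of_tendsto hlim ?_
      filter_upwards [Ioo_mem_nhdsGT hv] with u hu
      have := h.rpow_mul_tail_le hα hα1 (h0.symm.trans_le hu.1.le) hu.1 hu.2.le
      rw [← h0] at this
      simp only [mul_zero, zero_add] at this
      exact this.trans (mul_le_of_le_one_right' prob_le_one)
    rw [nonpos_iff_eq_zero, mul_eq_zero] at hle
    refine hle.resolve_left (ne_of_gt ?_)
    rw [ENNReal.ofReal_pos]
    exact Real.rpow_pos_of_pos (mul_pos hα' hv) _
  have hU : Ioi (0 : ℝ) = ⋃ k : ℕ, Ioi (1 / ((k : ℝ) + 1)) := by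
    ext x
    simp only [mem_Ioi, mem_iUnion]
    refine ⟨fun hx => exists_nat_one_div_lt hx, fun ⟨k, hk⟩ => lt_trans (by positivity) hk⟩
  have h1 := D.law_Ioi_zero
  rw [hU, measure_iUnion_null fun k => hz _ (by positivity)] at h1
  simp at h1

end StronglyRegular

end ValueDist

/-! ### The condition on the collateral -/

open Set

/-- Up to the factor `1 / α`, the bound on the relative gain from a collateral of `x` reserves. -/
noncomputable def tailFactor (α x : ℝ) : ℝ := x * (1 / (α + (1 - α) * x)) ^ (1 / (1 - α))

/-- With t = y/x and L(x) = α + (1-α)x, Bernoulli gives t^{1-α} ≤ 1 + (1-α)(t-1), which is at most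
L(y)/L(x) because the cross-multiplied difference is α(1-α)(t-1)(x-1). This allows passing from R to
a smaller individual reserve. -/
theorem tailFactor_anti {α x y : ℝ} (hα : 0 < α) (hα1 : α < 1) (hx : 1 ≤ x) (hxy : x ≤ y) :
    tailFactor α y ≤ tailFactor α x := by
  have hα' : 0 < 1 - α := by linarith
  have hx0 : 0 < x := by linarith
  have hy0 : 0 < y := by linarith
  have hLx : 0 < α + (1 - α) * x := by positivity
  have hLy : 0 < α + (1 - α) * y := by positivity
  have ht : 1 ≤ y / x := (one_le_div hx0).2 hxy
  have h1 : (y / x) ^ (1 - α) ≤ (α + (1 - α) * y) / (α + (1 - α) * x) := by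
    have hb := rpow_one_add_le_one_add_mul_self (s := y / x - 1) (by linarith)
      (p := 1 - α) hα'.le (by linarith)
    rw [add_sub_cancel] at hb
    refine hb.trans ((le_div_iff₀ hLx).2 ?_)
    have hy : y = y / x * x := by field_simp
    have hprod := mul_nonneg (mul_pos hα hα').le
      (mul_nonneg (sub_nonneg.2 ht) (sub_nonneg.2 hx))
    generalize y / x = t at *
    subst hy
    nlinarith
  have h2 : y / x ≤ ((α + (1 - α) * y) / (α + (1 - α) * x)) ^ (1 / (1 - α)) := by
    have := Real.rpow_le_rpow (by positivity) h1 (show 0 ≤ 1 / (1 - α) by positivity)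
    rwa [← Real.rpow_mul (by positivity), mul_one_div_cancel hα'.ne', Real.rpow_one] at this
  unfold tailFactor
  rw [Real.div_rpow hLy.le hLx.le] at h2
  rw [Real.div_rpow zero_le_one hLy.le, Real.div_rpow zero_le_one hLx.le, Real.one_rpow]
  have hPx := Real.rpow_pos_of_pos hLx (1 / (1 - α))
  have hPy := Real.rpow_pos_of_pos hLy (1 / (1 - α))
  rw [div_le_div_iff₀ hx0 hPx] at h2
  rw [mul_one_div, mul_one_div, div_le_div_iff₀ hPy hPx]
  linarith

theorem mul_rpow_eq_tailFactor {α R f : ℝ} (hR : 0 < R) :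
    (R / ((1 - α) * f + α * R)) ^ (1 / (1 - α)) * (f / R) = tailFactor α (f / R) := by
  have : R / ((1 - α) * f + α * R) = 1 / (α + (1 - α) * (f / R)) := by
    rw [← div_div_div_cancel_right₀ hR.ne' R, div_self hR.ne', add_div, add_comm]
    congr 2
    · field_simp
    · ring
  rw [tailFactor, this, mul_comm]

/-- Dropping α from the denominator leaves a pure power of x, and the threshold is the point where
that power equals α/N. -/
theorem tailFactor_le_of_rpow_le {α N x : ℝ} (hα : 0 < α) (hα1 : α < 1) (hN : 1 ≤ N)
    (hx : (N / α) ^ ((1 - α) / α) * (1 - α) ^ (-(1 / α)) ≤ x) :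
    1 ≤ x ∧ 1 / α * tailFactor α x ≤ 1 / N := by
  have hα' : 0 < 1 - α := by linarith
  have hN0 : 0 < N := by linarith
  set x₀ := (N / α) ^ ((1 - α) / α) * (1 - α) ^ (-(1 / α)) with hx₀
  have h1 : 1 ≤ x₀ := by
    refine one_le_mul_of_one_le_of_one_le (Real.one_le_rpow ?_ (by positivity))
      (Real.one_le_rpow_of_pos_of_le_one_of_nonpos hα' (by linarith) ?_)
    · rw [one_le_div hα]; linarith
    · simp [hα.le]
  have hx₀0 : 0 < x₀ := by linarith
  refine ⟨h1.trans hx, ?_⟩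
  refine (mul_le_mul_of_nonneg_left (tailFactor_anti hα hα1 h1 hx) (by positivity)).trans ?_
  have h2 : tailFactor α x₀ ≤ x₀ * (1 / ((1 - α) * x₀)) ^ (1 / (1 - α)) := by
    unfold tailFactor
    gcongr
    linarith
  have h3 : x₀ * (1 / ((1 - α) * x₀)) ^ (1 / (1 - α)) =
      (1 - α) ^ (-(1 / (1 - α))) * x₀ ^ (-(α / (1 - α))) := by
    have e1 : 1 - 1 / (1 - α) = -(α / (1 - α)) := by field_simp; ring
    rw [one_div ((1 - α) * x₀), Real.inv_rpow (by positivity), ← Real.rpow_neg (by positivity),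
      Real.mul_rpow hα'.le hx₀0.le, ← e1, sub_eq_add_neg 1 (1 / (1 - α)), Real.rpow_add hx₀0, Real.rpow_one]
    ring
  have h4 : x₀ ^ (-(α / (1 - α))) = (α / N) * (1 - α) ^ (1 / (1 - α)) := by
    rw [hx₀, Real.mul_rpow (by positivity) (by positivity), ← Real.rpow_mul (by positivity),
      ← Real.rpow_mul hα'.le]
    have e1 : (1 - α) / α * -(α / (1 - α)) = -1 := by field_simp
    have e2 : -(1 / α) * -(α / (1 - α)) = 1 / (1 - α) := by field_simp
    rw [e1, e2, Real.rpow_neg_one, inv_div]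
  rw [h3, h4] at h2
  have h5 : (1 - α) ^ (-(1 / (1 - α))) * (1 - α) ^ (1 / (1 - α)) = 1 := by
    rw [← Real.rpow_add hα']; simp
  calc 1 / α * tailFactor α x₀
      ≤ 1 / α * ((1 - α) ^ (-(1 / (1 - α))) * ((α / N) * (1 - α) ^ (1 / (1 - α)))) := by gcongr
    _ = (1 / α * (α / N)) * ((1 - α) ^ (-(1 / (1 - α))) * (1 - α) ^ (1 / (1 - α))) := by ring
    _ = 1 / N := by rw [h5]; field_simp

/-! ### The gain from a single bidder -/

namespace ValueDist

variable {α : ℝ} {D : ValueDist}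

theorem affine_le (hα : 0 < α) {f : ℝ} (hf : D.reserve ≤ f) : α * D.reserve + (1 - α) * f ≤ f := by
  have := mul_le_mul_of_nonneg_left hf hα.le
  linarith

theorem law_Ici (D : ValueDist) (p : ℝ) : D.law (Ici p) = D.law (Ioi p) := by
  refine le_antisymm ?_ (measure_mono Ioi_subset_Ici_self)
  rw [← Ioi_union_left]
  exact (measure_union_le _ _).trans (by rw [D.law_singleton, add_zero])

theorem setLIntegral_Ici (D : ValueDist) (p : ℝ) (g : ℝ → ℝ≥0∞) :
    ∫⁻ x in Ici p, g x ∂D.law = ∫⁻ x in Ioi p, g x ∂D.law := by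
  refine le_antisymm ?_ (lintegral_mono_set Ioi_subset_Ici_self)
  rw [← Ioi_union_left]
  refine (lintegral_union_le _ _ _).trans ?_
  rw [Measure.restrict_eq_zero.2 (D.law_singleton p), lintegral_zero_measure, add_zero]

namespace StronglyRegular

/-- The left side is the tail integral beyond f. This covers a bidder who can never win unless bids
are concealed. -/
theorem lintegral_ofReal_sub_le (h : D.StronglyRegular α) (hα : 0 < α) (hα1 : α < 1) {f : ℝ}
    (hf : D.reserve ≤ f) :
    ∫⁻ x, ENNReal.ofReal (x - f) ∂D.law ≤ ENNReal.ofReal (f / α) * D.law (Ioi f) := by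
  have h1 := D.lintegral_setLIntegral_Iio (W := fun _ => 1) measurable_const (Ioi f)
  simp only [one_mul, setLIntegral_one, Ioi_inter_Iio, Real.volume_Ioo] at h1
  rw [h1]
  have h2 := h.mul_setLIntegral_Ioi_tail_le hα hα1 hf
  have hα0 : ENNReal.ofReal α ≠ 0 := by simpa using hα
  refine (ENNReal.mul_le_mul_iff_right hα0 ENNReal.ofReal_ne_top).1 (h2.trans ?_)
  rw [← mul_assoc, ← ENNReal.ofReal_mul hα.le, mul_div_cancel₀ _ hα.ne']
  gcongr
  exact affine_le hα hf

theorem mul_tail_add_setLIntegral_le (h : D.StronglyRegular α) (hα : 0 < α) (hα1 : α < 1)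
    {f p : ℝ} (hf : D.reserve ≤ f) (hp : f ≤ p) :
    ENNReal.ofReal f * D.law (Ioi p) + ∫⁻ t in Ioc f p, D.law (Ioi t) ≤
      ENNReal.ofReal (f / α) * D.law (Ioi f) := by
  have hr := h.reserve_nonneg hα
  have hf0 := hr.trans hf
  have h1 := h.mul_setLIntegral_tail_add_le hα hα1 hf hp
  have hab : D.law (Ioi p) ≤ D.law (Ioi f) := D.antitone_tail hp
  have hI : ∫⁻ t in Ioc f p, D.law (Ioi t) ≠ ∞ :=
    ne_top_of_le_ne_top (h.setLIntegral_tail_ne_top hα hα1 hf0)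
      (lintegral_mono_set Ioc_subset_Ioi_self)
  have ha := measure_ne_top D.law (Ioi p)
  have hb := measure_ne_top D.law (Ioi f)
  have hle := affine_le hα hf
  have hL0 : 0 ≤ α * D.reserve + (1 - α) * f :=
    add_nonneg (mul_nonneg hα.le hr) (mul_nonneg (by linarith) hf0)
  have hL : α * D.reserve + (1 - α) * f ≤ α * D.reserve + (1 - α) * p := by
    have := mul_le_mul_of_nonneg_left hp (show 0 ≤ 1 - α by linarith)
    linarith
  generalize α * D.reserve + (1 - α) * f = Lf at *
  generalize α * D.reserve + (1 - α) * p = Lp at *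
  generalize (∫⁻ t in Ioc f p, D.law (Ioi t)) = I at *
  generalize D.law (Ioi p) = a at *
  generalize D.law (Ioi f) = b at *
  lift I to ℝ≥0 using hI
  lift a to ℝ≥0 using ha
  lift b to ℝ≥0 using hb
  rw [← ENNReal.ofReal_coe_nnreal, ← ENNReal.ofReal_coe_nnreal, ← ENNReal.ofReal_coe_nnreal,
    ← ENNReal.ofReal_mul hα.le, ← ENNReal.ofReal_mul (hL0.trans hL), ← ENNReal.ofReal_mul hL0,
    ← ENNReal.ofReal_add (mul_nonneg hα.le I.coe_nonneg) (mul_nonneg (hL0.trans hL) a.coe_nonneg),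
    ENNReal.ofReal_le_ofReal_iff (mul_nonneg hL0 b.coe_nonneg)] at h1
  have hab : (a : ℝ) ≤ b := by exact_mod_cast hab
  rw [← ENNReal.ofReal_coe_nnreal, ← ENNReal.ofReal_coe_nnreal, ← ENNReal.ofReal_coe_nnreal,
    ← ENNReal.ofReal_mul hf0, ← ENNReal.ofReal_mul (by positivity),
    ← ENNReal.ofReal_add (by positivity) I.coe_nonneg]
  refine ENNReal.ofReal_le_ofReal ?_
  rw [div_mul_eq_mul_div, le_div_iff₀ hα]
  have ha0 : (0 : ℝ) ≤ a := a.coe_nonneg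
  -- From αI + L(p)a ≤ L(f)b one gets αI ≤ L(f)(b - a) ≤ f(b - a), and αfa ≤ fa supplies the rest.
  have e1 := mul_le_mul_of_nonneg_right hL ha0
  have e2 := mul_le_mul_of_nonneg_right hle (sub_nonneg.2 hab)
  have e3 := mul_le_mul_of_nonneg_left hα1.le (mul_nonneg hf0 ha0)
  nlinarith

/-- The revenue from a price `p ≥ f` together with the gain from values below `p` that are
served at the cost `f`. -/
theorem lintegral_deviation_le (h : D.StronglyRegular α) (hα : 0 < α) (hα1 : α < 1)
    {f p : ℝ} (hf : D.reserve ≤ f) (hp : f ≤ p) :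
    ∫⁻ x, (if p ≤ x then ENNReal.ofReal p else ENNReal.ofReal (x - f)) ∂D.law ≤
      ENNReal.ofReal (f / α) * D.law (Ioi f) := by
  have hf0 := (h.reserve_nonneg hα).trans hf
  refine le_trans ?_ (h.mul_tail_add_setLIntegral_le hα hα1 hf hp)
  have h1 := D.lintegral_setLIntegral_Iio (W := fun _ => 1) measurable_const (Ioc f p)
  simp only [one_mul] at h1
  rw [← h1, ← D.law_Ici, ← lintegral_indicator_const measurableSet_Ici,
    ← lintegral_add_left (measurable_const.indicator measurableSet_Ici)]
  refine lintegral_mono fun x => ?_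
  -- Both branches of the integrand are at most f·1[x ≥ p] + (min(p, x) - f)⁺.
  have h2 : ENNReal.ofReal (min p x - f) ≤ ∫⁻ _ in Ioc f p ∩ Iio x, 1 := by
    rw [setLIntegral_one, ← Real.volume_Ioo]
    refine measure_mono fun t ht => ?_
    exact ⟨⟨ht.1, (ht.2.trans_le (min_le_left _ _)).le⟩, ht.2.trans_le (min_le_right _ _)⟩
  simp only
  refine le_trans ?_ (add_le_add_right h2 _)
  by_cases hx : p ≤ x
  · rw [if_pos hx, indicator_of_mem (mem_Ici.2 hx), min_eq_left hx,
      ← ENNReal.ofReal_add hf0 (sub_nonneg.2 hp)]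
    exact ENNReal.ofReal_le_ofReal (by linarith)
  · rw [if_neg hx, min_eq_right (not_le.1 hx).le]
    exact le_add_self

/-- The tail at f is compared with the tail at the reserve by `rpow_mul_tail_le`; what remains is
1/n of the revenue of posting the reserve, at most E[φ⁺]/n. -/
theorem ofReal_div_mul_tail_le (h : D.StronglyRegular α) (hα : 0 < α) (hα1 : α < 1) {n : ℕ}
    (hn : 0 < n) {R f : ℝ} (hR : D.reserve ≤ R) (hf : R ≤ f)
    (hcond : 1 / α * tailFactor α (f / R) ≤ 1 / (n : ℝ)) :
    ENNReal.ofReal (f / α) * D.law (Ioi f) ≤ (n : ℝ≥0∞)⁻¹ * ∫⁻ x, D.posVirtual x ∂D.law := by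
  have hr := h.reserve_pos hα hα1
  have hR0 := hr.trans_le hR
  have hf0 := hR0.trans_le hf
  have hα' : 0 < 1 - α := by linarith
  set r := D.reserve with hrdef
  have hL : 0 < α * r + (1 - α) * f := by positivity
  have hLγ := Real.rpow_pos_of_pos hL (1 / (1 - α))
  have hn0 : (0 : ℝ) < n := by exact_mod_cast hn
  have htail : ENNReal.ofReal (f / α) * D.law (Ioi f) ≤
      ENNReal.ofReal (1 / (n : ℝ) * r) * D.law (Ioi r) := by
    have h1 := h.rpow_mul_tail_le hα hα1 le_rfl hr (hR.trans hf)
    rw [← hrdef, show α * r + (1 - α) * r = r by ring] at h1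
    have h2 : f / α * r ^ (1 / (1 - α)) ≤
        1 / (n : ℝ) * r * (α * r + (1 - α) * f) ^ (1 / (1 - α)) := by
      -- The hypothesis concerns f/R; since r ≤ R, monotonicity moves it to f/r.
      have h3 := (mul_le_mul_of_nonneg_left (tailFactor_anti hα hα1 ((one_le_div hR0).2 hf)
        (div_le_div_of_nonneg_left hf0.le hr hR)) (by positivity : 0 ≤ 1 / α)).trans hcond
      rw [← mul_rpow_eq_tailFactor hr, add_comm ((1 - α) * f),
        Real.div_rpow hr.le hL.le] at h3
      have h4 := mul_le_mul_of_nonneg_right h3 (mul_pos hr hLγ).le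
      calc f / α * r ^ (1 / (1 - α)) = 1 / α * (r ^ (1 / (1 - α)) /
            (α * r + (1 - α) * f) ^ (1 / (1 - α)) * (f / r)) *
            (r * (α * r + (1 - α) * f) ^ (1 / (1 - α))) := by field_simp
        _ ≤ _ := h4
        _ = _ := by ring
    have hne : ENNReal.ofReal ((α * r + (1 - α) * f) ^ (1 / (1 - α))) ≠ 0 := by
      simpa using hLγ
    refine (ENNReal.mul_le_mul_iff_right hne ENNReal.ofReal_ne_top).1 ?_
    calc ENNReal.ofReal ((α * r + (1 - α) * f) ^ (1 / (1 - α))) *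
          (ENNReal.ofReal (f / α) * D.law (Ioi f))
        = ENNReal.ofReal (f / α) * (ENNReal.ofReal ((α * r + (1 - α) * f) ^ (1 / (1 - α))) *
          D.law (Ioi f)) := by ring
      _ ≤ ENNReal.ofReal (f / α) * (ENNReal.ofReal (r ^ (1 / (1 - α))) * D.law (Ioi r)) := by
          gcongr
      _ = ENNReal.ofReal (f / α * r ^ (1 / (1 - α))) * D.law (Ioi r) := by
          rw [← mul_assoc, ← ENNReal.ofReal_mul (by positivity)]
      _ ≤ ENNReal.ofReal (1 / (n : ℝ) * r * (α * r + (1 - α) * f) ^ (1 / (1 - α))) *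
          D.law (Ioi r) := by gcongr
      _ = _ := by
          rw [ENNReal.ofReal_mul (by positivity)]; ring
  refine htail.trans ?_
  rw [ENNReal.ofReal_mul (by positivity), mul_assoc, one_div, ENNReal.ofReal_inv_of_pos hn0,
    ENNReal.ofReal_natCast]
  gcongr
  exact (D.price_mul_tail_le hr.le (h.setLIntegral_tail_ne_top hα hα1 hr.le)).trans
    (setLIntegral_le_lintegral _ _)

end StronglyRegular

end ValueDist

theorem reserve_le_maxReserve {n : ℕ} (D : Fin n → ValueDist) (i : Fin n) :
    (D i).reserve ≤ maxReserve D :=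
  le_ciSup (f := fun i => (D i).reserve) (Set.finite_range _).bddAbove i

open Set

/-! ### Critical bids, payments and their measurability -/

namespace Contract

variable {ι : Type} {c : Contract ι} {b : ι → ℝ} {A : Finset ι} {i : ι}

theorem criticalBid_nonneg : 0 ≤ c.criticalBid b A i := Real.sInf_nonneg fun _ hx => hx.1

theorem criticalBid_eq [DecidableEq ι] (c : Contract ι) (b : ι → ℝ) (A : Finset ι) (i : ι) :
    c.criticalBid b A i = sInf {x : ℝ | 0 ≤ x ∧ i ∈ c.opt (Function.update b i x) A} := by
  unfold criticalBid
  simp only [wins_iff_mem_opt]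
  congr!

theorem criticalBid_update [DecidableEq ι] (x : ℝ) :
    c.criticalBid (Function.update b i x) A i = c.criticalBid b A i := by
  simp only [criticalBid_eq, Function.update_idem]

theorem bddBelow_winning {P : ℝ → Prop} : BddBelow {x : ℝ | 0 ≤ x ∧ P x} := ⟨0, fun _ hx => hx.1⟩

theorem criticalBid_le (hi : i ∈ c.opt b A) : c.criticalBid b A i ≤ b i := by
  classical
  rw [criticalBid_eq]
  refine csInf_le bddBelow_winning ⟨bid_nonneg_of_mem_opt hi, ?_⟩
  rwa [Function.update_eq_self]

theorem criticalBid_le_of_subset {A' : Finset ι} (hA : A' ⊆ A) (hiA : i ∈ A')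
    (hi : i ∈ c.opt b A) : c.criticalBid b A' i ≤ c.criticalBid b A i := by
  classical
  rw [criticalBid_eq, criticalBid_eq]
  refine csInf_le_csInf bddBelow_winning ⟨b i, bid_nonneg_of_mem_opt hi, ?_⟩ fun x hx => ?_
  · rwa [Function.update_eq_self]
  · exact ⟨hx.1, opt_mono_revealed hA hiA hx.2⟩

/-- A winning bid `x₀` must exist: for a bidder who never wins, `sInf ∅ = 0` would give a spurious
critical bid. -/
theorem mem_opt_of_criticalBid_lt [DecidableEq ι] (hreg : ∀ i, (c.dist i).Regular) {x₀ x : ℝ}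
    (h₀ : i ∈ c.opt (Function.update b i x₀) A) (hx : c.criticalBid b A i < x) :
    i ∈ c.opt (Function.update b i x) A := by
  have h₀' : 0 ≤ x₀ := by simpa using bid_nonneg_of_mem_opt h₀
  have hne : {x : ℝ | 0 ≤ x ∧ i ∈ c.opt (Function.update b i x) A}.Nonempty := ⟨x₀, h₀', h₀⟩
  rw [criticalBid_eq] at hx
  obtain ⟨y, hy, hyx⟩ := (csInf_lt_iff bddBelow_winning hne).1 hx
  exact mem_opt_update_of_le hreg hyx.le hy.2

theorem criticalBid_le_of_mem_opt [DecidableEq ι] {x : ℝ}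
    (h : i ∈ c.opt (Function.update b i x) A) : c.criticalBid b A i ≤ x := by
  simpa [criticalBid_update] using criticalBid_le h

theorem le_criticalBid [DecidableEq ι] (hreg : ∀ i, (c.dist i).Regular) {x₀ : ℝ}
    (h₀ : i ∈ c.opt (Function.update b i x₀) A) (hi : i ∉ c.opt b A) :
    b i ≤ c.criticalBid b A i := by
  by_contra! hlt
  have := mem_opt_of_criticalBid_lt hreg h₀ hlt
  rw [Function.update_eq_self] at this
  exact hi this

theorem payment_nonneg : 0 ≤ c.payment b A i := by
  unfold payment
  split_ifs
  exacts [criticalBid_nonneg, le_rfl]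

theorem payment_of_mem_opt (hi : i ∈ c.opt b A) : c.payment b A i = c.criticalBid b A i :=
  if_pos (wins_iff_mem_opt.2 hi)

theorem payment_of_notMem_opt (hi : i ∉ c.opt b A) : c.payment b A i = 0 :=
  if_neg fun h => hi (wins_iff_mem_opt.1 h)

theorem payment_le_abs : c.payment b A i ≤ |b i| := by
  by_cases hi : i ∈ c.opt b A
  · rw [payment_of_mem_opt hi]
    exact (criticalBid_le hi).trans (le_abs_self _)
  · rw [payment_of_notMem_opt hi]
    exact abs_nonneg _

/-- The allocated set maximizes the sum of the positive parts of the virtual values. -/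
theorem sum_posVirtual_le {T : Finset ι} (hTA : T ⊆ A) (hT : c.feasible.Indep (T : Set ι)) :
    ∑ i ∈ T, (c.dist i).posVirtual (b i) ≤ ∑ i ∈ c.opt b A, (c.dist i).posVirtual (b i) := by
  classical
  have hsum : ∀ S : Finset ι, (∀ i ∈ S, 0 ≤ (c.dist i).virtualValue (b i)) →
      0 ≤ c.surplus b S ∧
      (c.surplus b S).toENNReal = ∑ i ∈ S, (c.dist i).posVirtual (b i) := by
    intro S
    induction S using Finset.induction_on with
    | empty => intro _; simp [surplus]
    | insert i S hi ih =>
      intro h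
      obtain ⟨h1, h2⟩ := ih fun j hj => h j (Finset.mem_insert_of_mem hj)
      have h3 := h i (Finset.mem_insert_self _ _)
      rw [c.surplus_insert b hi, Finset.sum_insert hi, ← h2, EReal.toENNReal_add h3 h1]
      exact ⟨add_nonneg h3 h1, rfl⟩
  -- Members of negative virtual value have positive part 0, and discarding them preserves
  -- independence.
  have h1 : ∑ i ∈ T, (c.dist i).posVirtual (b i) =
      ∑ i ∈ T with 0 ≤ (c.dist i).virtualValue (b i), (c.dist i).posVirtual (b i) := by
    refine (Finset.sum_filter_of_ne fun i _ hne => ?_).symm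
    by_contra! h
    exact hne (EReal.toENNReal_of_nonpos h.le)
  rw [h1, ← (hsum _ fun i hi => (Finset.mem_filter.1 hi).2).2,
    ← (hsum _ fun i hi => virtualValue_nonneg_of_mem_opt hi).2]
  exact EReal.toENNReal_le_toENNReal ((c.isOptimal_opt b A).surplus_le
    ((Finset.filter_subset _ _).trans hTA) (hT.subset fun i hi => (Finset.mem_filter.1 hi).1))

section Measurability

variable {Ω : Type*} [MeasurableSpace Ω] {B : Ω → ι → ℝ}

theorem measurable_virtualValue_comp (hreg : ∀ i, (c.dist i).Regular)
    (hB : ∀ j, Measurable fun ω => B ω j) (j : ι) :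
    Measurable fun ω => (c.dist j).virtualValue (B ω j) :=
  (hreg j).measurable.comp (hB j)

/-- By the greedy description, winning depends on the bids through comparisons of virtual values and
a set of better bids with finitely many possible values. -/
theorem measurableSet_mem_opt [Finite ι] (hreg : ∀ i, (c.dist i).Regular)
    (hB : ∀ j, Measurable fun ω => B ω j) (A : Finset ι) (i : ι) :
    MeasurableSet {ω | i ∈ c.opt (B ω) A} := by
  have hφ := measurable_virtualValue_comp hreg hB
  have hset : Measurable fun ω => {j | j ∈ A ∧ c.Better (B ω) j i} := by
    refine measurable_set_iff.2 fun j => ?_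
    refine measurableSet_setOfPred.1 ((MeasurableSet.const _).inter ?_)
    refine (measurableSet_lt (hφ i) (hφ j)).union ?_
    exact (measurableSet_eq_fun (hφ i) (hφ j)).inter (MeasurableSet.const _)
  simp_rw [mem_opt_iff]
  refine (MeasurableSet.const _).inter ((MeasurableSet.const _).inter
    ((measurableSet_le measurable_const (hφ i)).inter ?_))
  exact hset (Set.toFinite {Y : Set ι | i ∉ c.feasible.closure Y}).measurableSet

theorem measurable_update_bid [DecidableEq ι] (hB : ∀ j, Measurable fun ω => B ω j) (i : ι)
    (x : ℝ) (j : ι) :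
    Measurable fun ω => Function.update (B ω) i x j := by
  by_cases hj : j = i
  · subst hj
    simp
  · simpa [Function.update_of_ne hj] using hB j

theorem measurable_criticalBid [Finite ι] (hreg : ∀ i, (c.dist i).Regular)
    (hB : ∀ j, Measurable fun ω => B ω j) (A : Finset ι) (i : ι) :
    Measurable fun ω => c.criticalBid (B ω) A i := by
  classical
  have hwin : ∀ x : ℝ, MeasurableSet {ω | i ∈ c.opt (Function.update (B ω) i x) A} := fun x =>
    measurableSet_mem_opt hreg (measurable_update_bid hB i x) A i
  refine measurable_of_Iio fun t => ?_
  -- Winning bids form an up-set, so rational bids suffice. The second piece collects the bids of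
  -- the others at which i never wins and the infimum defaults to 0.
  have : (fun ω => c.criticalBid (B ω) A i) ⁻¹' Iio t =
      (⋃ q : ℚ, {ω | (0 ≤ (q : ℝ) ∧ (q : ℝ) < t) ∧
        i ∈ c.opt (Function.update (B ω) i q) A}) ∪
      ((⋂ k : ℕ, {ω | i ∈ c.opt (Function.update (B ω) i (k : ℝ)) A}ᶜ) ∩ {ω | 0 < t}) := by
    ext ω
    simp only [mem_preimage, mem_Iio, mem_union, mem_iUnion, mem_inter_iff, mem_iInter,
      mem_compl_iff, mem_ofPred_eq]
    constructor
    · intro hlt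
      by_cases hne : ∃ k : ℕ, i ∈ c.opt (Function.update (B ω) i (k : ℝ)) A
      · left
        obtain ⟨k, hk⟩ := hne
        obtain ⟨q, hq1, hq2⟩ := exists_rat_btwn hlt
        exact ⟨q, ⟨criticalBid_nonneg.trans hq1.le, hq2⟩, mem_opt_of_criticalBid_lt hreg hk hq1⟩
      · right
        push Not at hne
        refine ⟨hne, ?_⟩
        rwa [criticalBid_eq, (?_ : {x : ℝ | 0 ≤ x ∧ i ∈ c.opt (Function.update (B ω) i x) A} = ∅),
          Real.sInf_empty] at hlt
        refine eq_empty_of_forall_notMem fun x hx => ?_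
        obtain ⟨k, hk⟩ := exists_nat_ge x
        exact hne k (mem_opt_update_of_le hreg hk hx.2)
    · rintro (⟨q, hq, hmem⟩ | ⟨hne, ht⟩)
      · exact (criticalBid_le_of_mem_opt hmem).trans_lt hq.2
      · rwa [criticalBid_eq, (?_ : {x : ℝ | 0 ≤ x ∧ i ∈ c.opt (Function.update (B ω) i x) A} = ∅),
          Real.sInf_empty]
        refine eq_empty_of_forall_notMem fun x hx => ?_
        obtain ⟨k, hk⟩ := exists_nat_ge x
        exact hne k (mem_opt_update_of_le hreg hk hx.2)
  rw [this]
  exact (MeasurableSet.iUnion fun q : ℚ => (MeasurableSet.const _).inter (hwin (q : ℝ))).union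
    ((MeasurableSet.iInter fun k : ℕ => (hwin (k : ℝ)).compl).inter (MeasurableSet.const _))

theorem measurable_payment [Finite ι] (hreg : ∀ i, (c.dist i).Regular)
    (hB : ∀ j, Measurable fun ω => B ω j) (A : Finset ι) (i : ι) :
    Measurable fun ω => c.payment (B ω) A i := by
  have hwin : MeasurableSet {ω | c.Wins (B ω) A i} := by
    simpa only [wins_iff_mem_opt] using measurableSet_mem_opt hreg hB A i
  exact Measurable.ite hwin (measurable_criticalBid hreg hB A i)
    measurable_const

end Measurability

end Contract

/-! ### Measurability and integrability of the revenue -/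

namespace Strategy

variable {n : ℕ} (π : Strategy n)

theorem bids_update (v : Fin n → ℝ) (i : Fin n) (x : ℝ) :
    π.bids (Function.update v i x) = Function.update (π.bids v) (Sum.inl i) x := by
  funext j
  rcases j with j | j
  · by_cases hj : j = i
    · subst hj; simp [bids]
    · simp [bids, hj]
  · simp [bids]

theorem measurable_bids (j : Fin n ⊕ Fin π.numFake) : Measurable fun v => π.bids v j := by
  rcases j with j | j
  · exact measurable_pi_apply j
  · exact measurable_const

theorem measurableSet_conceal_eq (C : Finset (Fin π.numFake)) :
    MeasurableSet {v | π.conceal v = C} := by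
  have : {v | π.conceal v = C} = ⋂ j, {v | j ∈ π.conceal v ↔ j ∈ C} := by
    ext v
    simp [Finset.ext_iff]
  rw [this]
  refine MeasurableSet.iInter fun j => ?_
  by_cases hj : j ∈ C
  · simpa [hj] using π.measurable_conceal j
  · simp only [hj, iff_false]
    exact (π.measurable_conceal j).compl

theorem measurable_revenue (hreg : ∀ i, (π.contract.dist i).Regular) (f : ℝ) :
    Measurable (π.revenue f) := by
  classical
  -- The concealed set takes finitely many values, so the revenue is glued from pieces on which it
  -- is constant.
  have : π.revenue f = fun v => ∑ C : Finset (Fin π.numFake), {v | π.conceal v = C}.indicator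
      (fun v => ∑ i, π.contract.payment (π.bids v) (Finset.univ.disjSum Cᶜ) (Sum.inl i) -
        f * (C.card : ℝ)) v := by
    funext v
    rw [Finset.sum_eq_single (π.conceal v)]
    · rw [indicator_of_mem (show v ∈ {w | π.conceal w = π.conceal v} from rfl)]; rfl
    · intro C _ hC
      rw [indicator_of_notMem (show v ∉ {w | π.conceal w = C} from fun h => hC (Eq.symm h))]
    · simp
  rw [this]
  refine Finset.measurable_fun_sum _ fun C _ =>
    Measurable.indicator ?_ (π.measurableSet_conceal_eq C)
  refine Measurable.sub_const (Finset.measurable_fun_sum _ fun i _ => ?_) _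
  exact Contract.measurable_payment hreg π.measurable_bids _ _

theorem abs_revenue_le (f : ℝ) (v : Fin n → ℝ) :
    |π.revenue f v| ≤ ∑ i, |v i| + |f| * π.numFake := by
  refine (abs_sub _ _).trans (add_le_add ?_ ?_)
  · refine (Finset.abs_sum_le_sum_abs _ _).trans (Finset.sum_le_sum fun i _ => ?_)
    rw [abs_of_nonneg Contract.payment_nonneg]
    exact Contract.payment_le_abs
  · rw [abs_mul, Nat.abs_cast]
    gcongr
    simpa using Finset.card_le_univ (π.conceal v)

theorem integrable_revenue {D : Fin n → ValueDist} (hD : ∀ i, Integrable (fun x => x) (D i).law)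
    (hreg : ∀ i, (π.contract.dist i).Regular) (f : ℝ) :
    Integrable (π.revenue f) (Measure.pi fun i => (D i).law) := by
  refine Integrable.mono' (g := fun v => ∑ i, |v i| + |f| * π.numFake) ?_
    (π.measurable_revenue hreg f).aestronglyMeasurable
    (Filter.Eventually.of_forall fun v => π.abs_revenue_le f v)
  refine (integrable_finsetSum _ fun i _ => ?_).add (integrable_const _)
  exact ((measurePreserving_eval (fun i => (D i).law) i).integrable_comp_of_integrable (hD i)).abs

end Strategy

open Set

/-! ### Charging the revenue to virtual surplus -/

namespace Strategy

variable {n : ℕ} (π : Strategy n)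

/-- The allocated set when no bid is concealed. -/
noncomputable def fullOpt (v : Fin n → ℝ) : Finset (Fin n ⊕ Fin π.numFake) :=
  π.contract.opt (π.bids v) Finset.univ

/-- The critical bid of `i` when no bid is concealed. -/
noncomputable def fullPrice (v : Fin n → ℝ) (i : Fin n) : ℝ :=
  π.contract.criticalBid (π.bids v) Finset.univ (Sum.inl i)

/-- The bids of the others allow `i` to be served, at a price above `f`, only because some bids
are concealed. This does not depend on the bid of `i`. -/
def Pivotal (M : Matroid (Fin n)) (f : ℝ) (v : Fin n → ℝ) (i : Fin n) : Prop :=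
  (f ≤ π.fullPrice v i ∨ ∀ x, Sum.inl i ∉ π.fullOpt (Function.update v i x)) ∧
    M.Indep {j | j = i ∨ Sum.inl j ∈ π.fullOpt (Function.update v i (-1))}

open Classical in
/-- An upper bound on the contribution of `i` to the revenue. -/
noncomputable def gain (M : Matroid (Fin n)) (f : ℝ) (v : Fin n → ℝ) (i : Fin n) : ℝ≥0∞ :=
  if Sum.inl i ∈ π.fullOpt v then ENNReal.ofReal (π.fullPrice v i)
  else if π.Pivotal M f v i then ENNReal.ofReal (v i - f) else 0

open Classical in
/-- The virtual surplus that pays for the contribution of `i` to the revenue. -/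
noncomputable def credit (M : Matroid (Fin n)) (D : Fin n → ValueDist) (f : ℝ) (v : Fin n → ℝ)
    (i : Fin n) : ℝ≥0∞ :=
  if π.Pivotal M f v i then (n : ℝ≥0∞)⁻¹ * (D i).posVirtual (v i)
  else if Sum.inl i ∈ π.fullOpt v then (D i).posVirtual (v i) else 0

theorem fullPrice_nonneg (v : Fin n → ℝ) (i : Fin n) : 0 ≤ π.fullPrice v i :=
  Contract.criticalBid_nonneg

theorem fullPrice_update (v : Fin n → ℝ) (i : Fin n) (x : ℝ) :
    π.fullPrice (Function.update v i x) i = π.fullPrice v i := by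
  rw [fullPrice, bids_update, Contract.criticalBid_update, fullPrice]

/-- This independence dictates the form of `Pivotal`: i is withdrawn by the bid -1, and the case of
never winning is listed separately because the price then defaults to 0. -/
theorem pivotal_update (M : Matroid (Fin n)) (f : ℝ) (v : Fin n → ℝ) (i : Fin n) (x : ℝ) :
    π.Pivotal M f (Function.update v i x) i ↔ π.Pivotal M f v i := by
  simp only [Pivotal, fullPrice_update, Function.update_idem]

variable {π} {M : Matroid (Fin n)} {D : Fin n → ValueDist} {f : ℝ} {v : Fin n → ℝ} {i : Fin n}

theorem fullOpt_update_of_notMem (hi : Sum.inl i ∉ π.fullOpt v) :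
    π.fullOpt (Function.update v i (-1)) = π.fullOpt v := by
  rw [fullOpt, bids_update]
  exact Contract.opt_update_of_notMem hi (by norm_num)

theorem mem_fullOpt_of_fullPrice_lt (hreg : ∀ i, (π.contract.dist i).Regular) {x₀ x : ℝ}
    (h₀ : Sum.inl i ∈ π.fullOpt (Function.update v i x₀)) (hx : π.fullPrice v i < x) :
    Sum.inl i ∈ π.fullOpt (Function.update v i x) := by
  rw [fullOpt, bids_update] at h₀ ⊢
  exact Contract.mem_opt_of_criticalBid_lt hreg h₀ hx

theorem fullPrice_le_of_mem_fullOpt {x : ℝ}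
    (h : Sum.inl i ∈ π.fullOpt (Function.update v i x)) : π.fullPrice v i ≤ x := by
  rw [fullOpt, bids_update] at h
  exact Contract.criticalBid_le_of_mem_opt h

theorem allocated_eq (v : Fin n → ℝ) :
    π.allocated v = {i | Sum.inl i ∈ π.contract.opt (π.bids v) (π.revealed v)} := by
  ext i
  exact Contract.wins_iff_mem_opt

theorem inl_mem_revealed (v : Fin n → ℝ) (i : Fin n) : Sum.inl i ∈ π.revealed v := by
  simp [revealed]

theorem mem_allocated_of_mem_fullOpt (hi : Sum.inl i ∈ π.fullOpt v) : i ∈ π.allocated v := by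
  rw [allocated_eq]
  exact Contract.opt_mono_revealed (Finset.subset_univ _) (inl_mem_revealed v i) hi

/-- A real bidder served because of a concealment, with a bid above `f`, is pivotal. -/
theorem pivotal_of_mem_allocated (hreg : ∀ i, (π.contract.dist i).Regular)
    (hM : M.Indep (π.allocated v)) (hi : i ∈ π.allocated v) (hi' : Sum.inl i ∉ π.fullOpt v)
    (hf : f ≤ v i) : π.Pivotal M f v i := by
  refine ⟨?_, hM.subset ?_⟩
  · by_cases h : ∃ x, Sum.inl i ∈ π.fullOpt (Function.update v i x)
    · obtain ⟨x, hx⟩ := h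
      rw [fullOpt, bids_update] at hx
      exact Or.inl (hf.trans (Contract.le_criticalBid hreg hx hi'))
    · exact Or.inr (not_exists.1 h)
  · rw [fullOpt_update_of_notMem hi']
    rintro j (rfl | hj)
    exacts [hi, mem_allocated_of_mem_fullOpt hj]

/-- If i already wins, the set lies inside the allocated one; if not, withdrawing i changes nothing
and pivotality applies. -/
theorem indep_insert_of_pivotal (hM : M.Indep (π.allocated v)) (hi : π.Pivotal M f v i) :
    M.Indep {j | j = i ∨ Sum.inl j ∈ π.fullOpt v} := by
  by_cases hi' : Sum.inl i ∈ π.fullOpt v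
  · refine hM.subset ?_
    rintro j (rfl | hj)
    exacts [mem_allocated_of_mem_fullOpt hi', mem_allocated_of_mem_fullOpt hj]
  · have := hi.2
    rwa [fullOpt_update_of_notMem hi'] at this

open Classical in
/-- At most one more real bidder is served for each concealed bid. -/
theorem card_extra_le (v : Fin n → ℝ) :
    (Finset.univ.filter fun i => i ∈ π.allocated v ∧ Sum.inl i ∉ π.fullOpt v).card ≤
      (π.conceal v).card := by
  have h1 : (Finset.univ.filter fun i => i ∈ π.allocated v ∧ Sum.inl i ∉ π.fullOpt v).card ≤
      (π.contract.opt (π.bids v) (π.revealed v) \ π.fullOpt v).card := by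
    refine Finset.card_le_card_of_injOn Sum.inl (fun i hi => ?_) Sum.inl_injective.injOn
    simp only [Finset.coe_filter, Finset.mem_univ, true_and, allocated_eq] at hi
    exact Finset.mem_coe.2 (Finset.mem_sdiff.2 hi)
  have h2 : (Finset.univ \ π.revealed v).card ≤ (π.conceal v).card := by
    have : Finset.univ \ π.revealed v ⊆ (π.conceal v).map Function.Embedding.inr := by
      intro j hj
      rcases j with j | j
      · simp [revealed] at hj
      · simpa [revealed] using hj
    simpa using Finset.card_le_card this
  exact h1.trans ((Contract.card_opt_sdiff_le (Finset.subset_univ _)).trans h2)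

theorem ofReal_sum_le {ι : Type*} (s : Finset ι) (a : ι → ℝ) :
    ENNReal.ofReal (∑ i ∈ s, a i) ≤ ∑ i ∈ s, ENNReal.ofReal (a i) := by
  calc ENNReal.ofReal (∑ i ∈ s, a i) ≤ ENNReal.ofReal (∑ i ∈ s, max (a i) 0) :=
        ENNReal.ofReal_le_ofReal (Finset.sum_le_sum fun i _ => le_max_left _ _)
    _ = ∑ i ∈ s, ENNReal.ofReal (max (a i) 0) :=
        ENNReal.ofReal_sum_of_nonneg fun i _ => le_max_right _ _
    _ = _ := by simp

/-- Concealment only lowers the price of a winner of `fullOpt`. An extra winner pays at most its bid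
and is charged one concealed bid; this is profitable only if v_i > f, and then i is pivotal. -/
theorem ofReal_revenue_le (hreg : ∀ i, (π.contract.dist i).Regular) (hf : 0 ≤ f)
    (hM : M.Indep (π.allocated v)) :
    ENNReal.ofReal (π.revenue f v) ≤ ∑ i, π.gain M f v i := by
  classical
  set a : Fin n → ℝ := fun i =>
    if Sum.inl i ∈ π.fullOpt v then π.fullPrice v i
    else if i ∈ π.allocated v then v i - f else 0 with ha
  have hle : π.revenue f v ≤ ∑ i, a i := by
    have h1 : ∀ i, π.contract.payment (π.bids v) (π.revealed v) (Sum.inl i) ≤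
        a i + f * (if i ∈ π.allocated v ∧ Sum.inl i ∉ π.fullOpt v then 1 else 0) := by
      intro i
      by_cases hi : Sum.inl i ∈ π.fullOpt v
      · have hi2 := mem_allocated_of_mem_fullOpt hi
        rw [allocated_eq] at hi2
        rw [Contract.payment_of_mem_opt hi2]
        simp only [ha, hi, if_true, not_true, and_false, if_false, mul_zero, add_zero]
        exact Contract.criticalBid_le_of_subset (Finset.subset_univ _) (inl_mem_revealed v i) hi
      · by_cases hi2 : i ∈ π.allocated v
        · simp only [ha, hi, hi2, if_true, not_false_iff, and_self, if_false, mul_one,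
            sub_add_cancel]
          rw [allocated_eq] at hi2
          rw [Contract.payment_of_mem_opt hi2]
          exact Contract.criticalBid_le hi2
        · simp only [ha, hi, hi2, false_and, if_false, mul_zero, add_zero]
          rw [allocated_eq] at hi2
          rw [Contract.payment_of_notMem_opt hi2]
    have h2 := Finset.sum_le_sum fun i (_ : i ∈ Finset.univ) => h1 i
    rw [Finset.sum_add_distrib, ← Finset.mul_sum, Finset.sum_boole] at h2
    have h3 : f * ((Finset.univ.filter fun i =>
        i ∈ π.allocated v ∧ Sum.inl i ∉ π.fullOpt v).card : ℝ) ≤ f * (π.conceal v).card :=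
      mul_le_mul_of_nonneg_left (by exact_mod_cast card_extra_le v) hf
    unfold revenue
    linarith
  refine (ENNReal.ofReal_le_ofReal hle).trans ((ofReal_sum_le _ _).trans
    (Finset.sum_le_sum fun i _ => ?_))
  by_cases hi : Sum.inl i ∈ π.fullOpt v
  · simp [ha, gain, hi]
  · by_cases hi2 : i ∈ π.allocated v
    · by_cases hfi : f ≤ v i
      · simp [ha, gain, hi, hi2, pivotal_of_mem_allocated hreg hM hi2 hi hfi]
      · have : ENNReal.ofReal (v i - f) = 0 := by
          rw [ENNReal.ofReal_eq_zero]; linarith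
        simp [ha, hi, hi2, this]
    · simp [ha, hi, hi2]

section Measurability

theorem measurableSet_mem_fullOpt (hreg : ∀ i, (π.contract.dist i).Regular)
    (j : Fin n ⊕ Fin π.numFake) : MeasurableSet {v | j ∈ π.fullOpt v} :=
  Contract.measurableSet_mem_opt hreg π.measurable_bids _ _

theorem measurable_fullPrice (hreg : ∀ i, (π.contract.dist i).Regular) (i : Fin n) :
    Measurable fun v => π.fullPrice v i :=
  Contract.measurable_criticalBid hreg π.measurable_bids _ _

theorem measurableSet_pivotal (hreg : ∀ i, (π.contract.dist i).Regular) (M : Matroid (Fin n))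
    (f : ℝ) (i : Fin n) : MeasurableSet {v | π.Pivotal M f v i} := by
  have hupd : ∀ x : ℝ, Measurable fun v : Fin n → ℝ => Function.update v i x := fun x =>
    measurable_update_left
  have hnever : MeasurableSet {v | ∀ x, Sum.inl i ∉ π.fullOpt (Function.update v i x)} := by
    -- Winning is monotone in the bid, so testing natural numbers suffices.
    have : {v | ∀ x, Sum.inl i ∉ π.fullOpt (Function.update v i x)} =
        ⋂ k : ℕ, {v | Sum.inl i ∈ π.fullOpt (Function.update v i (k : ℝ))}ᶜ := by
      ext v
      simp only [mem_ofPred_eq, mem_iInter, mem_compl_iff]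
      refine ⟨fun h k => h k, fun h x hx => ?_⟩
      obtain ⟨k, hk⟩ := exists_nat_gt (π.fullPrice v i)
      exact h k (mem_fullOpt_of_fullPrice_lt hreg hx hk)
    rw [this]
    exact MeasurableSet.iInter fun k : ℕ =>
      ((hupd (k : ℝ)) (measurableSet_mem_fullOpt hreg (Sum.inl i))).compl
  have hset : Measurable fun v => {j | j = i ∨ Sum.inl j ∈ π.fullOpt (Function.update v i (-1))} := by
    refine measurable_set_iff.2 fun j => measurableSet_setOfPred.1 ?_
    exact (MeasurableSet.const _).union
      ((hupd (-1)) (measurableSet_mem_fullOpt hreg (Sum.inl j)))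
  exact ((measurableSet_le measurable_const (measurable_fullPrice hreg i)).union hnever).inter
    (hset (Set.toFinite {Y : Set (Fin n) | M.Indep Y}).measurableSet)

theorem measurable_gain (hreg : ∀ i, (π.contract.dist i).Regular) (M : Matroid (Fin n))
    (f : ℝ) (i : Fin n) : Measurable fun v => π.gain M f v i := by
  refine Measurable.ite (measurableSet_mem_fullOpt hreg _)
    (measurable_fullPrice hreg i).ennreal_ofReal
    (Measurable.ite (measurableSet_pivotal hreg M f i) ?_ measurable_const)
  have : Measurable fun v : Fin n → ℝ => v i := measurable_pi_apply i
  exact (this.sub_const f).ennreal_ofReal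

theorem measurable_posVirtual_comp (D : Fin n → ValueDist) (i : Fin n) :
    Measurable fun v : Fin n → ℝ => (D i).posVirtual (v i) :=
  (D i).measurable_posVirtual.comp (measurable_pi_apply i)

theorem measurable_credit (hreg : ∀ i, (π.contract.dist i).Regular) (M : Matroid (Fin n))
    (D : Fin n → ValueDist) (f : ℝ) (i : Fin n) : Measurable fun v => π.credit M D f v i :=
  Measurable.ite (measurableSet_pivotal hreg M f i)
    ((measurable_posVirtual_comp D i).const_mul _)
    (Measurable.ite (measurableSet_mem_fullOpt hreg _) (measurable_posVirtual_comp D i)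
      measurable_const)

end Measurability

theorem lintegral_pi_le_of_update {D : Fin n → ValueDist} {F G : (Fin n → ℝ) → ℝ≥0∞} (i : Fin n)
    (hF : Measurable F) (hG : Measurable G)
    (h : ∀ v, ∫⁻ x, F (Function.update v i x) ∂(D i).law ≤
      ∫⁻ x, G (Function.update v i x) ∂(D i).law) :
    ∫⁻ v, F v ∂(Measure.pi fun i => (D i).law) ≤ ∫⁻ v, G v ∂(Measure.pi fun i => (D i).law) := by
  refine lintegral_le_of_lmarginal_le {i} hF hG fun v => ?_
  rw [lmarginal_singleton, lmarginal_singleton]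
  exact h v

/-- With the other bids fixed, pivotality and the price are constants, so only a one-dimensional
integral over v_i remains: the deviation bound if i is pivotal, Myerson's bound for a posted price
if not. -/
theorem lintegral_gain_le (hreg : ∀ i, (π.contract.dist i).Regular) {D : Fin n → ValueDist}
    {α : ℝ} (hα : 0 < α) (hα1 : α < 1) (hD : ∀ i, (D i).StronglyRegular α) {R : ℝ}
    (hR : ∀ i, (D i).reserve ≤ R) (hf : R ≤ f)
    (hcond : 1 / α * tailFactor α (f / R) ≤ 1 / (n : ℝ)) (i : Fin n) :
    ∫⁻ v, π.gain M f v i ∂(Measure.pi fun i => (D i).law) ≤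
      ∫⁻ v, π.credit M D f v i ∂(Measure.pi fun i => (D i).law) := by
  classical
  refine lintegral_pi_le_of_update i (measurable_gain hreg M f i) (measurable_credit hreg M D f i)
    fun v => ?_
  have hrf := (hR i).trans hf
  have hp0 := π.fullPrice_nonneg v i
  simp only [gain, credit, pivotal_update, fullPrice_update, Function.update_self]
  by_cases hG : π.Pivotal M f v i
  · simp only [hG, if_true]
    rw [lintegral_const_mul _ (D i).measurable_posVirtual]
    refine le_trans ?_ ((hD i).ofReal_div_mul_tail_le hα hα1 (Fin.pos i) (hR i) hf hcond)
    by_cases hex : ∃ x, Sum.inl i ∈ π.fullOpt (Function.update v i x)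
    · have hfp : f ≤ π.fullPrice v i := hG.1.resolve_right fun h => by
        obtain ⟨x, hx⟩ := hex
        exact h x hx
      refine le_trans (lintegral_mono fun x => ?_) ((hD i).lintegral_deviation_le hα hα1 hrf hfp)
      obtain ⟨x₀, hx₀⟩ := hex
      simp only
      by_cases hx : Sum.inl i ∈ π.fullOpt (Function.update v i x)
      · rw [if_pos hx, if_pos (fullPrice_le_of_mem_fullOpt hx)]
      · have hxp : x ≤ π.fullPrice v i := by
          by_contra! hlt
          exact hx (mem_fullOpt_of_fullPrice_lt hreg hx₀ hlt)
        rw [if_neg hx]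
        split_ifs
        · have := ((hD i).reserve_nonneg hα).trans hrf
          exact ENNReal.ofReal_le_ofReal (by linarith)
        · exact le_rfl
    · refine le_trans (lintegral_mono fun x => ?_) ((hD i).lintegral_ofReal_sub_le hα hα1 hrf)
      simp only
      rw [if_neg fun hx => hex ⟨x, hx⟩]
  · simp only [hG, if_false]
    by_cases hex : ∃ x, Sum.inl i ∈ π.fullOpt (Function.update v i x)
    · obtain ⟨x₀, hx₀⟩ := hex
      calc ∫⁻ x, (if Sum.inl i ∈ π.fullOpt (Function.update v i x) then
            ENNReal.ofReal (π.fullPrice v i) else 0) ∂(D i).law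
          ≤ ∫⁻ x, (Ici (π.fullPrice v i)).indicator
              (fun _ => ENNReal.ofReal (π.fullPrice v i)) x ∂(D i).law := by
            refine lintegral_mono fun x => ?_
            simp only
            split_ifs with hx
            · rw [indicator_of_mem (mem_Ici.2 (fullPrice_le_of_mem_fullOpt hx))]
            · exact zero_le
        _ = ENNReal.ofReal (π.fullPrice v i) * (D i).law (Ioi (π.fullPrice v i)) := by
            rw [lintegral_indicator_const measurableSet_Ici, ValueDist.law_Ici]
        _ ≤ ∫⁻ x in Ioi (π.fullPrice v i), (D i).posVirtual x ∂(D i).law :=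
            (D i).price_mul_tail_le hp0 ((hD i).setLIntegral_tail_ne_top hα hα1 hp0)
        _ ≤ _ := by
            rw [← lintegral_indicator measurableSet_Ioi]
            refine lintegral_mono fun x => ?_
            by_cases hx : x ∈ Ioi (π.fullPrice v i)
            · rw [indicator_of_mem hx, if_pos (mem_fullOpt_of_fullPrice_lt hreg hx₀ hx)]
            · rw [indicator_of_notMem hx]
              exact zero_le
    · refine lintegral_mono fun x => ?_
      simp only
      rw [if_neg fun hx => hex ⟨x, hx⟩, if_neg fun hx => hex ⟨x, hx⟩]

open Classical in
/-- A bidder whose distribution is declared truthfully pays at least its virtual surplus. -/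
theorem lintegral_posVirtual_le_payment (hreg : ∀ i, (π.contract.dist i).Regular) {α : ℝ}
    (hα : 0 < α) (hα1 : α < 1) (hD : ∀ i, (D i).StronglyRegular α) (i : Fin n)
    (hi : π.contract.dist (Sum.inl i) = D i) :
    ∫⁻ v, (if Sum.inl i ∈ π.fullOpt v then (D i).posVirtual (v i) else 0)
        ∂(Measure.pi fun i => (D i).law) ≤
      ∫⁻ v, ENNReal.ofReal (π.contract.payment (π.bids v) Finset.univ (Sum.inl i))
        ∂(Measure.pi fun i => (D i).law) := by
  refine lintegral_pi_le_of_update i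
    (Measurable.ite (measurableSet_mem_fullOpt hreg _) (measurable_posVirtual_comp D i)
      measurable_const)
    (Contract.measurable_payment hreg π.measurable_bids _ _).ennreal_ofReal fun v => ?_
  have hp0 := π.fullPrice_nonneg v i
  simp only [Function.update_self]
  by_cases hex : ∃ x, Sum.inl i ∈ π.fullOpt (Function.update v i x)
  · obtain ⟨x₀, hx₀⟩ := hex
    -- Any winner has nonnegative declared virtual value, here the true one.
    have hφ : ∀ x, π.fullPrice v i < x → 0 ≤ (D i).virtualValue x := fun x hx => by
      have := Contract.virtualValue_nonneg_of_mem_opt (mem_fullOpt_of_fullPrice_lt hreg hx₀ hx)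
      rwa [hi, bids, Sum.elim_inl, Function.update_self] at this
    calc ∫⁻ x, (if Sum.inl i ∈ π.fullOpt (Function.update v i x) then
          (D i).posVirtual x else 0) ∂(D i).law
        ≤ ∫⁻ x, (Ici (π.fullPrice v i)).indicator (D i).posVirtual x ∂(D i).law := by
          refine lintegral_mono fun x => ?_
          simp only
          split_ifs with hx
          · rw [indicator_of_mem (mem_Ici.2 (fullPrice_le_of_mem_fullOpt hx))]
          · exact zero_le
      _ = ∫⁻ x in Ioi (π.fullPrice v i), (D i).posVirtual x ∂(D i).law := by
          rw [lintegral_indicator measurableSet_Ici, ValueDist.setLIntegral_Ici]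
      _ ≤ ENNReal.ofReal (π.fullPrice v i) * (D i).law (Ioi (π.fullPrice v i)) :=
          (D i).setLIntegral_posVirtual_le hp0 ((hD i).setLIntegral_tail_ne_top hα hα1 hp0) hφ
      _ ≤ _ := by
          rw [← lintegral_indicator_const measurableSet_Ioi]
          refine lintegral_mono fun x => ?_
          by_cases hx : x ∈ Ioi (π.fullPrice v i)
          · rw [indicator_of_mem hx,
              Contract.payment_of_mem_opt (mem_fullOpt_of_fullPrice_lt hreg hx₀ hx)]
            exact ENNReal.ofReal_le_ofReal (π.fullPrice_update v i x).ge
          · rw [indicator_of_notMem hx]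
            exact zero_le
  · refine lintegral_mono fun x => ?_
    simp only
    rw [if_neg fun hx => hex ⟨x, hx⟩]
    exact zero_le

/-- Feasible allocations give at least the credited virtual surplus. -/
theorem sum_credit_le (hM : M.Indep (π.allocated v)) {O : ℝ≥0∞}
    (hO : ∀ T : Finset (Fin n), M.Indep (T : Set (Fin n)) →
      ∑ i ∈ T, (D i).posVirtual (v i) ≤ O) :
    ∑ i, π.credit M D f v i ≤ O := by
  classical
  set P := Finset.univ.filter fun i => π.Pivotal M f v i with hP
  set X := Finset.univ.filter fun i => ¬ π.Pivotal M f v i ∧ Sum.inl i ∈ π.fullOpt v with hX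
  have hsum : ∑ i, π.credit M D f v i =
      ∑ i ∈ P, (n : ℝ≥0∞)⁻¹ * (D i).posVirtual (v i) + ∑ i ∈ X, (D i).posVirtual (v i) := by
    rw [hP, hX, Finset.sum_filter, Finset.sum_filter, ← Finset.sum_add_distrib]
    refine Finset.sum_congr rfl fun i _ => ?_
    by_cases h1 : π.Pivotal M f v i <;> by_cases h2 : Sum.inl i ∈ π.fullOpt v <;>
      simp [credit, h1, h2]
  rw [hsum]
  rcases P.eq_empty_or_nonempty with hne | hne
  · rw [hne, Finset.sum_empty, zero_add]
    refine hO X (hM.subset fun i hi => ?_)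
    exact mem_allocated_of_mem_fullOpt (by simpa [hX] using hi : _ ∧ _).2
  -- At most n pivotal bidders with weight 1/n are paid for by the largest of them, k, which can
  -- join the nonpivotal winners feasibly.
  · obtain ⟨k, hk, hmax⟩ := P.exists_max_image (fun i => (D i).posVirtual (v i)) hne
    have hkP : π.Pivotal M f v k := (Finset.mem_filter.1 hk).2
    have hn : (n : ℝ≥0∞) ≠ 0 := by
      have := Fin.pos k
      exact_mod_cast this.ne'
    have h1 : ∑ i ∈ P, (n : ℝ≥0∞)⁻¹ * (D i).posVirtual (v i) ≤ (D k).posVirtual (v k) := by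
      calc ∑ i ∈ P, (n : ℝ≥0∞)⁻¹ * (D i).posVirtual (v i)
          ≤ ∑ i ∈ P, (n : ℝ≥0∞)⁻¹ * (D k).posVirtual (v k) :=
            Finset.sum_le_sum fun i hi => mul_le_mul_right (hmax i hi) _
        _ = (P.card : ℝ≥0∞) * ((n : ℝ≥0∞)⁻¹ * (D k).posVirtual (v k)) := by
            rw [Finset.sum_const, nsmul_eq_mul]
        _ ≤ (n : ℝ≥0∞) * ((n : ℝ≥0∞)⁻¹ * (D k).posVirtual (v k)) := by
            gcongr
            simpa using P.card_le_univ
        _ = _ := by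
            rw [← mul_assoc, ENNReal.mul_inv_cancel hn (by simp), one_mul]
    have hkX : k ∉ X := fun h => (Finset.mem_filter.1 h).2.1 hkP
    refine (add_le_add_left h1 _).trans ?_
    rw [← Finset.sum_insert (f := fun i => (D i).posVirtual (v i)) hkX]
    refine hO _ ((indep_insert_of_pivotal hM hkP).subset fun i hi => ?_)
    rcases Finset.mem_insert.1 (Finset.mem_coe.1 hi) with h | h
    · exact Or.inl h
    · exact Or.inr (Finset.mem_filter.1 h).2.2

/-! ### The honest strategy -/

section Honest

theorem honest_revealed (v : Fin n → ℝ) : (honest M D).revealed v = Finset.univ := by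
  ext j
  rcases j with j | j
  · simp [revealed]
  · exact j.elim0

theorem honest_indep (I : Set (Fin n ⊕ Fin 0)) (hI : (honest M D).contract.feasible.Indep I) :
    M.Indep (Sum.inl ⁻¹' I) := by
  have hI : (M.mapEquiv (Equiv.sumEmpty (Fin n) (Fin 0)).symm).Indep I := hI
  rw [Matroid.mapEquiv_indep_iff] at hI
  exact hI.subset fun i hi => ⟨Sum.inl i, hi, rfl⟩

theorem honest_indep_image {T : Set (Fin n)} (hT : M.Indep T) :
    (honest M D).contract.feasible.Indep (Sum.inl '' T) := by
  change (M.mapEquiv (Equiv.sumEmpty (Fin n) (Fin 0)).symm).Indep (Sum.inl '' T : Set (Fin n ⊕ Fin 0))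
  rw [Matroid.mapEquiv_indep_iff]
  refine hT.subset ?_
  rintro _ ⟨_, ⟨i, hi, rfl⟩, rfl⟩
  exact hi

theorem honest_regular (hreg : ∀ i, (D i).Regular) (i : Fin n ⊕ Fin 0) :
    ((honest M D).contract.dist i).Regular := hreg _

theorem honest_admissible (hreg : ∀ i, (D i).Regular) : (honest M D).Admissible M D := by
  refine ⟨honest_regular hreg, Filter.Eventually.of_forall fun v => ?_⟩
  rw [allocated_eq]
  exact honest_indep _ (Contract.opt_indep _ _ _)

theorem honest_revenue (f : ℝ) (v : Fin n → ℝ) :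
    (honest M D).revenue f v =
      ∑ i, (honest M D).contract.payment ((honest M D).bids v) Finset.univ (Sum.inl i) := by
  rw [revenue, honest_revealed]
  simp [honest]

open Classical in
theorem sum_posVirtual_le_honest {T : Finset (Fin n)} (hT : M.Indep (T : Set (Fin n))) :
    ∑ i ∈ T, (D i).posVirtual (v i) ≤
      ∑ i, if Sum.inl i ∈ (honest M D).fullOpt v then (D i).posVirtual (v i) else 0 := by
  have h := Contract.sum_posVirtual_le (c := (honest M D).contract) (b := (honest M D).bids v)
    (T := T.map Function.Embedding.inl) (Finset.subset_univ _)
    (by rw [Finset.coe_map]; exact honest_indep_image hT)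
  rw [Finset.sum_map] at h
  refine h.trans ?_
  rw [← Finset.sum_filter]
  have hsub : (honest M D).fullOpt v =
      (Finset.univ.filter fun i => Sum.inl i ∈ (honest M D).fullOpt v).map
        Function.Embedding.inl := by
    ext j
    rcases j with j | j
    · simp
    · exact j.elim0
  change ∑ i ∈ (honest M D).fullOpt v, _ ≤ _
  conv_lhs => rw [hsub]
  rw [Finset.sum_map]
  exact le_rfl

end Honest

end Strategy

/-! ### Credibility and explicit collaterals -/

/-- The deferred-revelation auction is credible when the tail condition holds. -/
theorem credible_of_tailFactor_le {α : ℝ} (hα : 0 < α) (hα1 : α < 1) {n : ℕ}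
    {M : Matroid (Fin n)} {D : Fin n → ValueDist} (hD : ∀ i, (D i).StronglyRegular α) {f : ℝ}
    (hf0 : 0 ≤ f) (hf : maxReserve D ≤ f)
    (hcond : 1 / α * tailFactor α (f / maxReserve D) ≤ 1 / (n : ℝ)) : Credible M D f := by
  classical
  have hDreg : ∀ i, (D i).Regular := fun i => (hD i).regular hα.le
  have hint : ∀ i, Integrable (fun x => x) (D i).law := fun i => (hD i).integrable_id hα hα1
  refine ⟨Strategy.honest_admissible hDreg, fun π hπ => ⟨π.integrable_revenue hint hπ.1 f, ?_⟩⟩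
  set μ := Measure.pi fun i => (D i).law
  have hI := π.integrable_revenue hint hπ.1 f
  have hIh := (Strategy.honest M D).integrable_revenue hint
    (Strategy.honest_regular (M := M) hDreg) f
  -- A deviation may have negative revenue; passing to its positive part allows the comparison to
  -- run in `ℝ≥0∞`.
  have hIp : Integrable (fun v => max (π.revenue f v) 0) μ := hI.pos_part
  have hnn : ∀ v, 0 ≤ (Strategy.honest M D).revenue f v := fun v => by
    rw [Strategy.honest_revenue]
    exact Finset.sum_nonneg fun i _ => Contract.payment_nonneg
  have key : ∫⁻ v, ENNReal.ofReal (π.revenue f v) ∂μ ≤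
      ∫⁻ v, ENNReal.ofReal ((Strategy.honest M D).revenue f v) ∂μ := by
    calc ∫⁻ v, ENNReal.ofReal (π.revenue f v) ∂μ
        ≤ ∫⁻ v, ∑ i, π.gain M f v i ∂μ := by
          refine lintegral_mono_ae ?_
          filter_upwards [hπ.2] with v hv
          exact Strategy.ofReal_revenue_le hπ.1 hf0 hv
      _ = ∑ i, ∫⁻ v, π.gain M f v i ∂μ :=
          lintegral_finsetSum _ fun i _ => Strategy.measurable_gain hπ.1 M f i
      _ ≤ ∑ i, ∫⁻ v, π.credit M D f v i ∂μ := Finset.sum_le_sum fun i _ =>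
          Strategy.lintegral_gain_le hπ.1 hα hα1 hD (reserve_le_maxReserve D) hf hcond i
      _ = ∫⁻ v, ∑ i, π.credit M D f v i ∂μ :=
          (lintegral_finsetSum _ fun i _ => Strategy.measurable_credit hπ.1 M D f i).symm
      _ ≤ ∫⁻ v, ∑ i, (if Sum.inl i ∈ (Strategy.honest M D).fullOpt v then
            (D i).posVirtual (v i) else 0) ∂μ := by
          refine lintegral_mono_ae ?_
          filter_upwards [hπ.2] with v hv
          exact Strategy.sum_credit_le hv fun T hT => Strategy.sum_posVirtual_le_honest hT
      _ = ∑ i, ∫⁻ v, (if Sum.inl i ∈ (Strategy.honest M D).fullOpt v then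
            (D i).posVirtual (v i) else 0) ∂μ :=
          lintegral_finsetSum _ fun i _ => Measurable.ite
            (Strategy.measurableSet_mem_fullOpt (Strategy.honest_regular hDreg) _)
            (Strategy.measurable_posVirtual_comp D i) measurable_const
      _ ≤ ∑ i, ∫⁻ v, ENNReal.ofReal ((Strategy.honest M D).contract.payment
            ((Strategy.honest M D).bids v) Finset.univ (Sum.inl i)) ∂μ :=
          Finset.sum_le_sum fun i _ => Strategy.lintegral_posVirtual_le_payment
            (Strategy.honest_regular hDreg) hα hα1 hD i rfl
      _ = ∫⁻ v, ∑ i, ENNReal.ofReal ((Strategy.honest M D).contract.payment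
            ((Strategy.honest M D).bids v) Finset.univ (Sum.inl i)) ∂μ :=
          (lintegral_finsetSum _ fun i _ => (Contract.measurable_payment
            (Strategy.honest_regular hDreg) (Strategy.honest M D).measurable_bids _ _).ennreal_ofReal).symm
      _ = ∫⁻ v, ENNReal.ofReal ((Strategy.honest M D).revenue f v) ∂μ := by
          refine lintegral_congr fun v => ?_
          rw [Strategy.honest_revenue, ENNReal.ofReal_sum_of_nonneg fun i _ =>
            Contract.payment_nonneg]
  calc ∫ v, π.revenue f v ∂μ ≤ ∫ v, max (π.revenue f v) 0 ∂μ :=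
        integral_mono hI hIp fun v => le_max_left _ _
    _ = (∫⁻ v, ENNReal.ofReal (π.revenue f v) ∂μ).toReal := by
        rw [integral_eq_lintegral_of_nonneg_ae (f := fun v => max (π.revenue f v) 0)
          (Filter.Eventually.of_forall fun v => le_max_right _ _) hIp.aestronglyMeasurable]
        simp
    _ ≤ (∫⁻ v, ENNReal.ofReal ((Strategy.honest M D).revenue f v) ∂μ).toReal := by
        refine ENNReal.toReal_mono ?_ key
        rw [← ofReal_integral_eq_lintegral_ofReal hIh (Filter.Eventually.of_forall hnn)]
        exact ENNReal.ofReal_ne_top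
    _ = ∫ v, (Strategy.honest M D).revenue f v ∂μ := by
        rw [integral_eq_lintegral_of_nonneg_ae (Filter.Eventually.of_forall hnn)
          hIh.aestronglyMeasurable]

theorem maxReserve_pos {α : ℝ} (hα : 0 < α) (hα1 : α < 1) {n : ℕ} (hn : 0 < n)
    {D : Fin n → ValueDist} (hD : ∀ i, (D i).StronglyRegular α) : 0 < maxReserve D :=
  ((hD ⟨0, hn⟩).reserve_pos hα hα1).trans_le (reserve_le_maxReserve D ⟨0, hn⟩)

theorem credible_mul_maxReserve {α : ℝ} (hα : 0 < α) (hα1 : α < 1) {n : ℕ} (hn : 0 < n)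
    {M : Matroid (Fin n)} {D : Fin n → ValueDist} (hD : ∀ i, (D i).StronglyRegular α) {x : ℝ}
    (hx : ((n : ℝ) / α) ^ ((1 - α) / α) * (1 - α) ^ (-(1 / α)) ≤ x) :
    Credible M D (x * maxReserve D) := by
  have hR := maxReserve_pos hα hα1 hn hD
  obtain ⟨h1, h2⟩ := tailFactor_le_of_rpow_le hα hα1 (by exact_mod_cast hn : (1 : ℝ) ≤ n) hx
  refine credible_of_tailFactor_le hα hα1 hD (by positivity) (le_mul_of_one_le_left hR.le h1) ?_
  rwa [mul_div_cancel_right₀ _ hR.ne']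

/-- For n ≥ 1, rounding the exponent of n up to an integer only increases the bound; the other
factors depend on α alone, which yields a monomial in n. -/
theorem rpow_le_mul_pow {α : ℝ} (hα : 0 < α) (hα1 : α < 1) {n : ℕ} (hn : 0 < n) :
    ((n : ℝ) / α) ^ ((1 - α) / α) * (1 - α) ^ (-(1 / α)) ≤
      α⁻¹ ^ ((1 - α) / α) * (1 - α) ^ (-(1 / α)) * (n : ℝ) ^ ⌈(1 - α) / α⌉₊ := by
  have hα' : 0 < 1 - α := by linarith
  have hn1 : (1 : ℝ) ≤ n := by exact_mod_cast hn
  have h1 : (n : ℝ) ^ ((1 - α) / α) ≤ (n : ℝ) ^ ⌈(1 - α) / α⌉₊ := by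
    rw [← Real.rpow_natCast]
    exact Real.rpow_le_rpow_of_exponent_le hn1 (Nat.le_ceil _)
  rw [div_eq_mul_inv, Real.mul_rpow (by positivity) (by positivity)]
  calc (n : ℝ) ^ ((1 - α) / α) * α⁻¹ ^ ((1 - α) / α) * (1 - α) ^ (-(1 / α))
      = α⁻¹ ^ ((1 - α) / α) * (1 - α) ^ (-(1 / α)) * (n : ℝ) ^ ((1 - α) / α) := by ring
    _ ≤ _ := by gcongr

end DRA

theorem mainTheorem2 (α : ℝ) (hα0 : 0 < α) (hα1 : α < 1) :
    (∀ (n : ℕ), 0 < n → ∀ (M : Matroid (Fin n)) (D : Fin n → DRA.ValueDist),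
      (∀ i, (D i).StronglyRegular α) →
      ∀ f : ℝ, DRA.maxReserve D ≤ f →
        1 / α * (DRA.maxReserve D / ((1 - α) * f + α * DRA.maxReserve D)) ^ (1 / (1 - α))
            * (f / DRA.maxReserve D) ≤ 1 / (n : ℝ) →
        DRA.Credible M D f) ∧
    (∀ (n : ℕ), 0 < n → ∀ (M : Matroid (Fin n)) (D : Fin n → DRA.ValueDist),
      (∀ i, (D i).StronglyRegular α) →
      DRA.Credible M D
        (((n : ℝ) / α) ^ ((1 - α) / α) * (1 - α) ^ (-(1 / α)) * DRA.maxReserve D)) ∧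
    (∃ p : Polynomial ℝ, ∀ (n : ℕ), 0 < n →
      ∀ (M : Matroid (Fin n)) (D : Fin n → DRA.ValueDist),
        (∀ i, (D i).StronglyRegular α) →
        DRA.Credible M D (p.eval (n : ℝ) * DRA.maxReserve D)) := by
  refine ⟨fun n hn M D hD f hf hcond => ?_, fun n hn M D hD => ?_, ?_⟩
  · have hR := DRA.maxReserve_pos hα0 hα1 hn hD
    refine DRA.credible_of_tailFactor_le hα0 hα1 hD (hR.le.trans hf) hf ?_
    rwa [← DRA.mul_rpow_eq_tailFactor hR, ← mul_assoc]
  · exact DRA.credible_mul_maxReserve hα0 hα1 hn hD le_rfl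
  · refine ⟨Polynomial.C (α⁻¹ ^ ((1 - α) / α) * (1 - α) ^ (-(1 / α))) *
      Polynomial.X ^ ⌈(1 - α) / α⌉₊, fun n hn M D hD => ?_⟩
    refine DRA.credible_mul_maxReserve hα0 hα1 hn hD ?_
    simpa using DRA.rpow_le_mul_pow hα0 hα1 hn
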